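/- Let $\mathcal{F}$ be the class of continuous log-concave probability densities on $\mathbb{R}$. For $f_0\in\mathcal{F}$ write $\mathrm{supp}(f_0)=\{f_0>0\}$ and $\phi_0=\log f_0$. A score function of $f_0$ is any $\psi_0:\mathbb{R}\to[-\infty,\infty]$ that lies between the right and the left derivative of $\phi_0$ on $\mathrm{supp}(f_0)$, with $\psi_0(x)=\infty$ for $x\le\inf\mathrm{supp}(f_0)$ and $\psi_0(x)=-\infty$ for $x\ge\sup\mathrm{supp}(f_0)$; it is unique up to countably many points of $\mathrm{supp}(f_0)$. Let $i(f_0)=\int\psi_0^2f_0$ be the Fisher information and, for $\hat\psi:\mathbb{R}\to\mathbb{R}$, let $\mathcal{L}(\hat\psi,\psi_0)=\int(\hat\psi-\psi_0)^2f_0$ be the loss (with $\infty\cdot 0=0$). For $\beta\in[1,2]$ and $L,r>0$, let $\mathcal{F}_{\beta,L,r}$ be the set of $f_0\in\mathcal{F}$ with $i(f_0)\le r$ whose score functions are finite and satisfy $|\psi_0(x)-\psi_0(y)|\le L|x-y|^{\beta-1}$ for all $x,y\in\mathbb{R}$ (where $0^0=1$). For $n\in\mathbb{N}=\{1,2,\dots\}$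 let $\hat\Psi_n$ be the set of jointly measurable functions $\hat\psi_n:\mathbb{R}\times\mathbb{R}^n\to\mathbb{R}$, let $X_1,\dots,X_n$ be independent with density $f_0$ under $\mathbb{P}_{f_0}$, and write $\mathcal{L}_n=\mathcal{L}(\hat\psi_n(\cdot;X_1,\dots,X_n),\psi_0)$. For $\mathcal{G}\subseteq\mathcal{F}$ and $\delta\in(0,1]$ define the minimax risk and the minimax $(1-\delta)$th quantile over $\mathcal{G}$ by $$\mathcal{M}_n(\mathcal{G})=\inf_{\hat\psi_n\in\hat\Psi_n}\sup_{f_0\in\mathcal{G}}\mathbb{E}_{f_0}(\mathcal{L}_n),\qquad \mathcal{M}_n(\delta,\mathcal{G})=\inf_{\hat\psi_n\in\hat\Psi_n}\sup_{f_0\in\mathcal{G}}\inf\bigl\{t\in[0,\infty):\mathbb{P}_{f_0}(\mathcal{L}_n\le t)\ge1-\delta\bigr\},$$ where $\inf\emptyset=\infty$. Theorem. There exist a universal constant $c>0$ and, for each $\beta\in[1,2]$, a constant $c_\beta>0$ depending only on $\beta$, such that for all $n\in\mathbb{N}$, $\delta\in(0,1/4]$, $\beta\in[1,2]$ and $L,r>0$,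 writing $r'=\min\{r,L^{2/\beta}\}$, $$\mathcal{M}_n(\delta,\mathcal{F}_{\beta,L,r})\ \ge\ c_\beta\, r'\min\Bigl\{\Bigl(\frac{L^{2/\beta}}{r'}\cdot\frac1n\Bigr)^{\beta/(2\beta+1)}+\Bigl(\frac{L^{2/\beta}}{r'}\cdot\frac{\log(1/\delta)}{n}\Bigr)^{\beta/(\beta+2)},\,1\Bigr\},$$ $$\mathcal{M}_n(\mathcal{F}_{\beta,L,r})\ \ge\ c\, r'\min\Bigl\{\Bigl(\frac{L^{2/\beta}}{r'}\cdot\frac1n\Bigr)^{\beta/(2\beta+1)},\,1\Bigr\}.$$ -/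

import Mathlib

open MeasureTheory Set
open scoped ENNReal NNReal

namespace ScoreEstimation

/-- `f` belongs to the class of all continuous, log-concave (Lebesgue) densities on `ℝ`.
Log-concavity: `supp f = {f > 0}` is convex and `log f` is concave on it. -/
structure IsContLogConcaveDensity (f : ℝ → ℝ) : Prop where
  continuous : Continuous f
  nonneg : ∀ x, 0 ≤ f x
  lintegral_eq_one : ∫⁻ x, ENNReal.ofReal (f x) = 1
  logConcave : ConcaveOn ℝ {x | 0 < f x} (fun x => Real.log (f x))

/-- The left derivative of the log-density `log f` at `x`. -/
noncomputable def leftLogDeriv (f : ℝ → ℝ) (x : ℝ) : ℝ :=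
  derivWithin (fun t => Real.log (f t)) (Iio x) x

/-- The right derivative of the log-density `log f` at `x`. -/
noncomputable def rightLogDeriv (f : ℝ → ℝ) (x : ℝ) : ℝ :=
  derivWithin (fun t => Real.log (f t)) (Ioi x) x

/-- `ψ : ℝ → [-∞, ∞]` is a (version of the) score function of `f`: it lies between the right and
the left derivative of `log f` on `supp f`, it is `∞` at all `x ≤ inf supp f`, and `-∞` at all
`x ≥ sup supp f`. -/
structure IsScore (f : ℝ → ℝ) (ψ : ℝ → EReal) : Prop where
  right_le : ∀ x, 0 < f x → (rightLogDeriv f x : EReal) ≤ ψ x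
  le_left : ∀ x, 0 < f x → ψ x ≤ (leftLogDeriv f x : EReal)
  eq_top : ∀ x, (∀ y, 0 < f y → x ≤ y) → ψ x = ⊤
  eq_bot : ∀ x, (∀ y, 0 < f y → y ≤ x) → ψ x = ⊥

open Classical in
/-- The right-continuous version of the score function of `f`, used to evaluate the loss and the
Fisher information. All versions agree on `supp f` outside a countable set. -/
noncomputable def score (f : ℝ → ℝ) (x : ℝ) : EReal :=
  if 0 < f x then (rightLogDeriv f x : EReal)
  else if ∀ y, 0 < f y → x ≤ y then ⊤ else ⊥

/-- `score f` is indeed a score function of `f`. -/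
theorem isScore_score {f : ℝ → ℝ} (hf : IsContLogConcaveDensity f) : IsScore f (score f) := by
  have hopen : IsOpen {x | 0 < f x} := isOpen_lt continuous_const hf.continuous
  have hne : ∃ y, 0 < f y := by
    by_contra h
    push Not at h
    have h0 : ∀ x, ENNReal.ofReal (f x) = 0 := fun x => ENNReal.ofReal_of_nonpos (h x)
    have := hf.lintegral_eq_one
    simp [h0] at this
  refine ⟨fun x hx => ?_, fun x hx => ?_, fun x hx => ?_, fun x hx => ?_⟩
  · simp [score, hx]
  · have hxi : x ∈ interior {x | 0 < f x} := by rwa [hopen.interior_eq]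
    have h := hf.logConcave.neg.leftDeriv_le_rightDeriv_of_mem_interior hxi
    rw [derivWithin.neg, derivWithin.neg] at h
    rw [score, if_pos hx, EReal.coe_le_coe_iff]
    exact neg_le_neg_iff.1 h
  · have hn : ¬ 0 < f x := by
      intro h
      obtain ⟨ε, hε, hb⟩ := Metric.isOpen_iff.1 hopen x h
      have := hx (x - ε / 2) (hb (by
        rw [Metric.mem_ball, Real.dist_eq, show x - ε / 2 - x = -(ε / 2) by ring, abs_neg,
          abs_of_pos (by linarith)]
        linarith))
      linarith
    rw [score, if_neg hn, if_pos hx]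
  · have hn : ¬ 0 < f x := by
      intro h
      obtain ⟨ε, hε, hb⟩ := Metric.isOpen_iff.1 hopen x h
      have := hx (x + ε / 2) (hb (by
        rw [Metric.mem_ball, Real.dist_eq, show x + ε / 2 - x = ε / 2 by ring,
          abs_of_pos (by linarith)]
        linarith))
      linarith
    have hn2 : ¬ ∀ y, 0 < f y → x ≤ y := by
      intro h
      obtain ⟨y, hy⟩ := hne
      have hxy : x = y := le_antisymm (h y hy) (hx y hy)
      exact hn (hxy ▸ hy)
    rw [score, if_neg hn, if_neg hn2]

/-- The loss `∫ (g - ψ)² f ∈ [0, ∞]`, with `∞ · 0 = 0`. -/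
noncomputable def loss (f : ℝ → ℝ) (g : ℝ → ℝ) (ψ : ℝ → EReal) : ℝ≥0∞ :=
  ∫⁻ x, ((g x : EReal) - ψ x).abs ^ 2 * ENNReal.ofReal (f x)

/-- The Fisher information for location `i(f) = ∫ ψ² f ∈ [0, ∞]`, with `∞ · 0 = 0`. -/
noncomputable def fisherInfo (f : ℝ → ℝ) : ℝ≥0∞ :=
  ∫⁻ x, (score f x).abs ^ 2 * ENNReal.ofReal (f x)

/-- The class `F_{β,L}`: continuous log-concave densities whose score functions satisfy
`|ψ x - ψ y| ≤ L |x - y| ^ (β - 1)` for all real `x, y`. In `EReal` the value `|∞ - ∞|` is `∞`, so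
the condition entails that `ψ` is finite everywhere. -/
def holderClass (β L : ℝ) : Set (ℝ → ℝ) :=
  {f | IsContLogConcaveDensity f ∧ ∀ ψ : ℝ → EReal, IsScore f ψ →
    ∀ x y : ℝ, (ψ x - ψ y).abs ≤ ENNReal.ofReal (L * |x - y| ^ (β - 1))}

/-- The class `F_{β,L,r}`: those `f` in `F_{β,L}` with Fisher information at most `r`. -/
def holderFisherClass (β L r : ℝ) : Set (ℝ → ℝ) :=
  {f | f ∈ holderClass β L ∧ fisherInfo f ≤ ENNReal.ofReal r}

/-- The joint law of `n` independent observations with density `f`. -/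
noncomputable def sampleLaw (n : ℕ) (f : ℝ → ℝ) : Measure (Fin n → ℝ) :=
  Measure.pi (fun _ => (volume : Measure ℝ).withDensity (fun x => ENNReal.ofReal (f x)))

/-- The estimators: jointly measurable functions `ℝ × ℝⁿ → ℝ`. -/
def Estimator (n : ℕ) : Type :=
  {g : ℝ → (Fin n → ℝ) → ℝ // Measurable (Function.uncurry g)}

/-- The loss of the estimator `g` when the density is `f` and the sample is `X`. -/
noncomputable def estLoss {n : ℕ} (g : Estimator n) (f : ℝ → ℝ) (X : Fin n → ℝ) : ℝ≥0∞ :=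
  loss f (fun x => g.1 x X) (score f)

/-- The minimax risk over the class `G`. -/
noncomputable def minimaxRisk (n : ℕ) (G : Set (ℝ → ℝ)) : ℝ≥0∞ :=
  ⨅ g : Estimator n, ⨆ f ∈ G, ∫⁻ X, estLoss g f X ∂(sampleLaw n f)

/-- The `(1 - δ)`-th quantile of the loss of `g` under `f`: the infimum of all `t ∈ [0, ∞)` with
`P_f (loss ≤ t) ≥ 1 - δ` (and `∞` if there is none). -/
noncomputable def lossQuantile {n : ℕ} (δ : ℝ) (g : Estimator n) (f : ℝ → ℝ) : ℝ≥0∞ :=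
  ⨅ (t : ℝ≥0) (_ : ENNReal.ofReal (1 - δ) ≤ sampleLaw n f {X | estLoss g f X ≤ t}), (t : ℝ≥0∞)

/-- The minimax `(1 - δ)`-th quantile of the loss over the class `G`. -/
noncomputable def minimaxQuantile (n : ℕ) (δ : ℝ) (G : Set (ℝ → ℝ)) : ℝ≥0∞ :=
  ⨅ g : Estimator n, ⨆ f ∈ G, lossQuantile δ g f

end ScoreEstimation

namespace ScoreEstimation

/-! A hypercube of log-concave densities is hidden in the class, so that an accurate estimator would
have to recover the bits of a vertex. At unit scale a density is flat on `[-K, K]`, and beyond that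
the slope of its negative log is a staircase with `m` steps of height `1 / (16 m)` and width `h`.
Each step has one of two shapes with the same integral, so flipping a bit changes the log-density on
that step only. The slopes are monotone whatever the bits, which keeps log-concavity. The left side
carries the complementary shapes: folding the line at `0` then pairs each shape with its opposite,
so the normalising constant, of order `K`, is the same at every vertex (`map_stair_add_compl`,
`lintegral_profile_eq`).

Take `a = L ^ (1 / β)` as inverse scale, `K = L ^ (2 / β) / r'`, and `m` of order `h ^ (1 - β)`. The
step height then matches `h ^ (β - 1)`, which gives the Hölder bound, while `a ^ 2 / K = r'`
controls the Fisher information (`profileDensity_mem`). One flipped bit costs at most `h ^ 3 / (1024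
m ^ 2 K)` in squared Hellinger distance, and one wrongly recovered bit costs the estimator a loss of
order `r' h / m ^ 2`. Hence `m / 16` wrong bits force a loss of order `r' h / m`, that is `r' h ^ β`
(`shapeErrors_mul_le_estLoss`).

For the first rate, neighbouring vertices stay indistinguishable while `h ^ (2 β + 1)` is at most `K
/ n`. Assouad's lemma and a reverse Markov bound then give a vertex with at least `m / 16` errors
with probability at least `5 / 16` (`exists_many_errors`), which serves both the risk and the
quantile. For the second rate only two opposite vertices are compared. Their distance is `m` times
larger, but an error probability above `δ` survives while `h ^ (β + 2)` is at most `K log (1 / δ) /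
n` (`exists_half_errors`). Choosing the largest such `h ≤ 1` gives the rates. -/

/-! ### Product laws, Hellinger affinity and testing errors. -/

theorem lintegral_pi_prod_eq_pow : ∀ (n : ℕ) (F : Fin n → ℝ → ℝ≥0∞), (∀ i, Measurable (F i)) →
    ∫⁻ X : Fin n → ℝ, ∏ i, F i (X i) = ∏ i, ∫⁻ x, F i x := by
  intro n
  induction n with
  | zero => intro F _; simp [volume_pi]
  | succ n ih =>
    intro F hF
    have mp := volume_preserving_piFinSuccAbove (fun _ : Fin (n + 1) => ℝ) 0
    have hm : Measurable fun p : ℝ × (Fin n → ℝ) => F 0 p.1 * ∏ i : Fin n, F i.succ (p.2 i) := by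
      refine ((hF 0).comp measurable_fst).mul (Finset.measurable_prod _ fun i _ => ?_)
      exact (hF i.succ).comp ((measurable_pi_apply i).comp measurable_snd)
    have h := mp.lintegral_comp hm
    rw [Fin.prod_univ_succ, ← ih (fun i => F i.succ) (fun i => hF _)]
    rw [← lintegral_prod_mul (hF 0).aemeasurable
      (Finset.measurable_prod _ fun i _ => (hF i.succ).comp (measurable_pi_apply i)).aemeasurable]
    rw [← Measure.volume_eq_prod, ← h]
    refine lintegral_congr fun X => ?_
    rw [Fin.prod_univ_succ]
    simp [MeasurableEquiv.piFinSuccAbove, Fin.insertNthEquiv, Fin.tail]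

theorem pi_withDensity_eq {n : ℕ} {F : ℝ → ℝ≥0∞} (hF : Measurable F) (h1 : ∫⁻ x, F x = 1) :
    Measure.pi (fun _ : Fin n => (volume : Measure ℝ).withDensity F)
      = (volume : Measure (Fin n → ℝ)).withDensity fun X => ∏ i, F (X i) := by
  have : IsProbabilityMeasure ((volume : Measure ℝ).withDensity F) :=
    ⟨by rw [withDensity_apply _ MeasurableSet.univ, Measure.restrict_univ, h1]⟩
  refine Measure.pi_eq fun s hs => ?_
  rw [withDensity_apply _ (MeasurableSet.univ_pi hs), ← lintegral_indicator (MeasurableSet.univ_pi hs)]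
  have : ∀ X : Fin n → ℝ, (univ.pi s).indicator (fun X => ∏ i, F (X i)) X
      = ∏ i, (s i).indicator F (X i) := by
    intro X
    by_cases hX : X ∈ univ.pi s
    · rw [indicator_of_mem hX]
      exact Finset.prod_congr rfl fun i _ => (indicator_of_mem (hX i (mem_univ i)) F).symm
    · rw [indicator_of_notMem hX]
      simp only [mem_pi, mem_univ, true_implies, not_forall] at hX
      obtain ⟨i, hi⟩ := hX
      exact (Finset.prod_eq_zero (Finset.mem_univ i) (indicator_of_notMem hi F)).symm
  simp_rw [this]
  rw [lintegral_pi_prod_eq_pow n _ fun i => hF.indicator (hs i)]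
  exact Finset.prod_congr rfl fun i _ => by
    rw [lintegral_indicator (hs i), withDensity_apply _ (hs i)]

/-- Puts all sample laws under one dominating measure, Lebesgue measure on `ℝⁿ`, so that their
affinity can be written as an integral. -/
theorem sampleLaw_eq {f : ℝ → ℝ} (hf : Measurable f) (h1 : ∫⁻ x, ENNReal.ofReal (f x) = 1) (n : ℕ) :
    sampleLaw n f
      = (volume : Measure (Fin n → ℝ)).withDensity fun X => ∏ i, ENNReal.ofReal (f (X i)) :=
  pi_withDensity_eq hf.ennreal_ofReal h1

theorem isProbabilityMeasure_sampleLaw {f : ℝ → ℝ} (h1 : ∫⁻ x, ENNReal.ofReal (f x) = 1) (n : ℕ) :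
    IsProbabilityMeasure (sampleLaw n f) := by
  have : IsProbabilityMeasure ((volume : Measure ℝ).withDensity fun x => ENNReal.ofReal (f x)) :=
    ⟨by rw [withDensity_apply _ MeasurableSet.univ, Measure.restrict_univ, h1]⟩
  unfold sampleLaw
  infer_instance

theorem lintegral_sqrt_mul_le {α : Type*} [MeasurableSpace α] (μ : Measure α) {p q : α → ℝ≥0∞}
    (hp : Measurable p) (hq : Measurable q) :
    ∫⁻ x, (p x * q x) ^ (1 / 2 : ℝ) ∂μ
      ≤ ((∫⁻ x, p x ∂μ) * ∫⁻ x, q x ∂μ) ^ (1 / 2 : ℝ) := by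
  have h := ENNReal.lintegral_mul_le_Lp_mul_Lq μ Real.HolderConjugate.two_two
    (hp.pow_const (1 / 2 : ℝ)).aemeasurable (hq.pow_const (1 / 2 : ℝ)).aemeasurable
  have e : ∀ y : ℝ≥0∞, (y ^ (1 / 2 : ℝ)) ^ (2 : ℝ) = y := fun y => by
    rw [← ENNReal.rpow_mul]; norm_num
  simp only [Pi.mul_apply, e] at h
  rw [ENNReal.mul_rpow_of_nonneg _ _ (by norm_num)]
  simpa only [ENNReal.mul_rpow_of_nonneg _ _ (show (0 : ℝ) ≤ 1 / 2 by norm_num)] using h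

/-- Le Cam's inequality between the testing affinity and the Hellinger affinity. -/
theorem sq_affinity_le_testing {α : Type*} [MeasurableSpace α] (μ : Measure α) {p q : α → ℝ≥0∞}
    (hp : Measurable p) (hq : Measurable q) (hp1 : ∫⁻ x, p x ∂μ = 1) (hq1 : ∫⁻ x, q x ∂μ = 1)
    {c : ℝ} (hc0 : 0 ≤ c) (hc : ENNReal.ofReal c ≤ ∫⁻ x, (p x * q x) ^ (1 / 2 : ℝ) ∂μ)
    {A : Set α} (hA : MeasurableSet A) {s : ℝ}
    (hs : s = ((μ.withDensity p) A).toReal + ((μ.withDensity q) Aᶜ).toReal) :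
    c ^ 2 ≤ s * (2 - s) := by
  have : IsProbabilityMeasure (μ.withDensity p) :=
    ⟨by rw [withDensity_apply _ MeasurableSet.univ, Measure.restrict_univ, hp1]⟩
  have : IsProbabilityMeasure (μ.withDensity q) :=
    ⟨by rw [withDensity_apply _ MeasurableSet.univ, Measure.restrict_univ, hq1]⟩
  -- Cauchy–Schwarz on `A` and on `Aᶜ` separately: with error probabilities `x` and `y`, the
  -- affinity is at most `√(x (1 - y)) + √((1 - x) y)`.
  rw [← lintegral_add_compl _ hA] at hc
  have h := hc.trans (add_le_add (lintegral_sqrt_mul_le (μ.restrict A) hp hq)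
    (lintegral_sqrt_mul_le (μ.restrict Aᶜ) hp hq))
  rw [← withDensity_apply _ hA, ← withDensity_apply _ hA, ← withDensity_apply _ hA.compl,
    ← withDensity_apply _ hA.compl] at h
  have hq' : ((μ.withDensity q) A).toReal = 1 - ((μ.withDensity q) Aᶜ).toReal := by
    have := probReal_compl_eq_one_sub (μ := μ.withDensity q) hA
    simp only [measureReal_def] at this; linarith
  have hp' : ((μ.withDensity p) Aᶜ).toReal = 1 - ((μ.withDensity p) A).toReal := by
    have := probReal_compl_eq_one_sub (μ := μ.withDensity p) hA
    simpa only [measureReal_def] using this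
  have hx0 : 0 ≤ ((μ.withDensity p) A).toReal := ENNReal.toReal_nonneg
  have hy0 : 0 ≤ ((μ.withDensity q) Aᶜ).toReal := ENNReal.toReal_nonneg
  have hx1 : 0 ≤ 1 - ((μ.withDensity p) A).toReal := hp' ▸ ENNReal.toReal_nonneg
  have hy1 : 0 ≤ 1 - ((μ.withDensity q) Aᶜ).toReal := hq' ▸ ENNReal.toReal_nonneg
  rw [← ENNReal.ofReal_toReal (measure_ne_top (μ.withDensity p) A),
    ← ENNReal.ofReal_toReal (measure_ne_top (μ.withDensity q) A),
    ← ENNReal.ofReal_toReal (measure_ne_top (μ.withDensity p) Aᶜ),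
    ← ENNReal.ofReal_toReal (measure_ne_top (μ.withDensity q) Aᶜ), hp', hq'] at h
  generalize ((μ.withDensity p) A).toReal = x at *
  generalize ((μ.withDensity q) Aᶜ).toReal = y at *
  rw [← ENNReal.ofReal_mul hx0, ← ENNReal.ofReal_mul hx1,
    ENNReal.ofReal_rpow_of_nonneg (mul_nonneg hx0 hy1) (by norm_num),
    ENNReal.ofReal_rpow_of_nonneg (mul_nonneg hx1 hy0) (by norm_num),
    ← Real.sqrt_eq_rpow, ← Real.sqrt_eq_rpow,
    ← ENNReal.ofReal_add (Real.sqrt_nonneg _) (Real.sqrt_nonneg _),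
    ENNReal.ofReal_le_ofReal_iff (by positivity)] at h
  rw [Real.sqrt_mul hx0, Real.sqrt_mul hx1] at h
  have e1 := Real.sq_sqrt hx0
  have e2 := Real.sq_sqrt hx1
  have e3 := Real.sq_sqrt hy0
  have e4 := Real.sq_sqrt hy1
  generalize √x = x1 at *
  generalize √(1 - x) = x2 at *
  generalize √y = y1 at *
  generalize √(1 - y) = y2 at *
  have h2 : c ^ 2 ≤ (x1 * y2 + x2 * y1) ^ 2 := pow_le_pow_left₀ hc0 h 2
  have h3 : s * (2 - s) = (x1 ^ 2 + y1 ^ 2) * (x2 ^ 2 + y2 ^ 2) := by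
    rw [e1, e2, e3, e4, hs]; ring
  rw [h3]
  -- Lagrange's identity: the gap between the two sides is exactly this square.
  nlinarith [sq_nonneg (x1 * x2 - y1 * y2)]

/-- Expanding the square gives `2 √f √g + (√f - √g)² = f + g`, which integrates to `2`. -/
theorem one_sub_half_le_affinity {f g : ℝ → ℝ} (hf : Measurable f) (hg : Measurable g)
    (hf0 : ∀ x, 0 ≤ f x) (hg0 : ∀ x, 0 ≤ g x)
    (hf1 : ∫⁻ x, ENNReal.ofReal (f x) = 1) (hg1 : ∫⁻ x, ENNReal.ofReal (g x) = 1) {η : ℝ}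
    (hη0 : 0 ≤ η) (hη : ∫⁻ x, ENNReal.ofReal ((√(f x) - √(g x)) ^ 2) ≤ ENNReal.ofReal η) :
    ENNReal.ofReal (1 - η / 2)
      ≤ ∫⁻ x, (ENNReal.ofReal (f x) * ENNReal.ofReal (g x)) ^ (1 / 2 : ℝ) := by
  have e : ∀ x, (ENNReal.ofReal (f x) * ENNReal.ofReal (g x)) ^ (1 / 2 : ℝ)
      = ENNReal.ofReal (√(f x) * √(g x)) := fun x => by
    rw [← ENNReal.ofReal_mul (hf0 x), ENNReal.ofReal_rpow_of_nonneg (mul_nonneg (hf0 x) (hg0 x))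
      (by norm_num), ← Real.sqrt_eq_rpow, Real.sqrt_mul (hf0 x)]
  simp_rw [e]
  have key : ∫⁻ x, (2 * ENNReal.ofReal (√(f x) * √(g x))
      + ENNReal.ofReal ((√(f x) - √(g x)) ^ 2)) = 2 := by
    have : ∀ x, 2 * ENNReal.ofReal (√(f x) * √(g x)) + ENNReal.ofReal ((√(f x) - √(g x)) ^ 2)
        = ENNReal.ofReal (f x) + ENNReal.ofReal (g x) := fun x => by
      rw [← ENNReal.ofReal_add (hf0 x) (hg0 x),
        show (2 : ℝ≥0∞) = ENNReal.ofReal 2 by norm_num, ← ENNReal.ofReal_mul (by norm_num),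
        ← ENNReal.ofReal_add (by positivity) (by positivity)]
      congr 1
      nlinarith [Real.sq_sqrt (hf0 x), Real.sq_sqrt (hg0 x)]
    simp_rw [this]
    rw [lintegral_add_left hf.ennreal_ofReal, hf1, hg1]
    norm_num
  have hm : Measurable fun x => ENNReal.ofReal (√(f x) * √(g x)) := by fun_prop
  rw [lintegral_add_left (hm.const_mul 2), lintegral_const_mul _ hm] at key
  have h2 : (2 : ℝ≥0∞) ≤ 2 * (∫⁻ x, ENNReal.ofReal (√(f x) * √(g x))) + ENNReal.ofReal η := by
    conv_lhs => rw [← key]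
    gcongr
  generalize (∫⁻ x, ENNReal.ofReal (√(f x) * √(g x))) = I at h2
  induction I with
  | top => exact le_top
  | coe I =>
    rw [show (2 : ℝ≥0∞) = ENNReal.ofReal 2 by norm_num,
      show (I : ℝ≥0∞) = ENNReal.ofReal I by simp, ← ENNReal.ofReal_mul (by norm_num),
      ← ENNReal.ofReal_add (by positivity) hη0, ENNReal.ofReal_le_ofReal_iff (by positivity)] at h2
    rw [show (I : ℝ≥0∞) = ENNReal.ofReal I by simp]
    exact ENNReal.ofReal_le_ofReal (by linarith)

/-- Testing two densities at squared Hellinger distance `η` from `n` observations. -/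
theorem testing_le_of_hellinger {f g : ℝ → ℝ} (hf : Measurable f) (hg : Measurable g)
    (hf0 : ∀ x, 0 ≤ f x) (hg0 : ∀ x, 0 ≤ g x)
    (hf1 : ∫⁻ x, ENNReal.ofReal (f x) = 1) (hg1 : ∫⁻ x, ENNReal.ofReal (g x) = 1) {η : ℝ}
    (hη0 : 0 ≤ η) (hη2 : η ≤ 2)
    (hη : ∫⁻ x, ENNReal.ofReal ((√(f x) - √(g x)) ^ 2) ≤ ENNReal.ofReal η) (n : ℕ)
    {A : Set (Fin n → ℝ)} (hA : MeasurableSet A) {s : ℝ}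
    (hs : s = (sampleLaw n f A).toReal + (sampleLaw n g Aᶜ).toReal) :
    (1 - η / 2) ^ (2 * n) ≤ s * (2 - s) := by
  have hm : ∀ {k : ℝ → ℝ}, Measurable k →
      Measurable fun X : Fin n → ℝ => ∏ i, ENNReal.ofReal (k (X i)) := fun hk =>
    Finset.measurable_prod _ fun i _ => (hk.comp (measurable_pi_apply i)).ennreal_ofReal
  have hi : ∀ {k : ℝ → ℝ}, Measurable k → ∫⁻ x, ENNReal.ofReal (k x) = 1 →
      ∫⁻ X : Fin n → ℝ, ∏ i, ENNReal.ofReal (k (X i)) = 1 := fun hk h1 => by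
    rw [lintegral_pi_prod_eq_pow n (fun _ x => ENNReal.ofReal (_)) fun _ => hk.ennreal_ofReal]
    simp [h1]
  rw [sampleLaw_eq hf hf1, sampleLaw_eq hg hg1] at hs
  rw [mul_comm, pow_mul]
  refine sq_affinity_le_testing volume (hm hf) (hm hg) (hi hf hf1) (hi hg hg1)
    (pow_nonneg (by linarith) n) ?_ hA hs
  -- The affinity of product densities is the `n`-th power of the affinity on the line; this is why
  -- Hellinger distance is used.
  have e : ∀ X : Fin n → ℝ,
      ((∏ i, ENNReal.ofReal (f (X i))) * ∏ i, ENNReal.ofReal (g (X i))) ^ (1 / 2 : ℝ)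
      = ∏ i, (ENNReal.ofReal (f (X i)) * ENNReal.ofReal (g (X i))) ^ (1 / 2 : ℝ) := fun X => by
    rw [← Finset.prod_mul_distrib, ENNReal.prod_rpow_of_nonneg (by norm_num)]
  simp_rw [e]
  rw [lintegral_pi_prod_eq_pow n
    (fun _ x => (ENNReal.ofReal (f x) * ENNReal.ofReal (g x)) ^ (1 / 2 : ℝ))
    fun _ => (hf.ennreal_ofReal.mul hg.ennreal_ofReal).pow_const _]
  rw [Finset.prod_const, Finset.card_univ, Fintype.card_fin, ENNReal.ofReal_pow (by linarith)]
  exact pow_le_pow_left₀ bot_le (one_sub_half_le_affinity hf hg hf0 hg0 hf1 hg1 hη0 hη) n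

/-! ### The two step shapes. -/

/-- Two continuous nondecreasing transitions from `0` to `1` on the unit interval. -/
noncomputable def stepSlope (k : Bool) (t : ℝ) : ℝ :=
  if k then 2 * (max (t - 1 / 4) 0 - max (t - 3 / 4) 0) else max t 0 - max (t - 1) 0

/-- The antiderivative of `stepSlope k` that vanishes on the negative half-line. -/
noncomputable def stepInt (k : Bool) (t : ℝ) : ℝ :=
  if k then max (t - 1 / 4) 0 ^ 2 - max (t - 3 / 4) 0 ^ 2 else (max t 0 ^ 2 - max (t - 1) 0 ^ 2) / 2

theorem hasDerivAt_max_sq (c t : ℝ) :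
    HasDerivAt (fun x : ℝ => max (x - c) 0 ^ 2) (2 * max (t - c) 0) t := by
  rcases lt_trichotomy t c with h | h | h
  · have : (fun x : ℝ => max (x - c) 0 ^ 2) =ᶠ[nhds t] fun _ => 0 := by
      filter_upwards [Iio_mem_nhds h] with x hx
      rw [max_eq_right (by simpa using (mem_Iio.1 hx).le)]; simp
    rw [max_eq_right (by linarith), mul_zero]
    exact (hasDerivAt_const t (0 : ℝ)).congr_of_eventuallyEq this
  · subst h
    simp only [sub_self, max_self, mul_zero]
    rw [hasDerivAt_iff_isLittleO]
    simp only [sub_self, max_self, smul_zero, sub_zero, ne_eq, OfNat.ofNat_ne_zero,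
      not_false_eq_true, zero_pow]
    have h1 : (fun x : ℝ => max (x - t) 0 ^ 2) =O[nhds t] fun x => (x - t) ^ 2 := by
      refine Asymptotics.isBigO_of_le _ fun x => ?_
      rw [Real.norm_eq_abs, Real.norm_eq_abs, abs_of_nonneg (sq_nonneg _),
        abs_of_nonneg (sq_nonneg _)]
      rcases max_cases (x - t) 0 with ⟨e, _⟩ | ⟨e, _⟩ <;> rw [e]
      nlinarith [sq_nonneg (x - t)]
    refine h1.trans_isLittleO ?_
    have := (Asymptotics.isLittleO_pow_id (𝕜 := ℝ) (n := 2) (by norm_num))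
    exact this.comp_tendsto (by
      have : Filter.Tendsto (fun x : ℝ => x - t) (nhds t) (nhds (t - t)) :=
        (continuous_sub_right t).tendsto t
      simpa using this)
  · have : (fun x : ℝ => max (x - c) 0 ^ 2) =ᶠ[nhds t] fun x => (x - c) ^ 2 := by
      filter_upwards [Ioi_mem_nhds h] with x hx
      rw [max_eq_left (by simpa using (mem_Ioi.1 hx).le)]
    rw [max_eq_left (by linarith)]
    refine HasDerivAt.congr_of_eventuallyEq ?_ this
    exact (((hasDerivAt_id t).sub_const c).fun_pow 2).congr_deriv (by simp)

theorem hasDerivAt_stepInt (k : Bool) (t : ℝ) : HasDerivAt (stepInt k) (stepSlope k t) t := by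
  cases k
  · have h := ((hasDerivAt_max_sq 0 t).sub (hasDerivAt_max_sq 1 t)).div_const 2
    simp only [sub_zero] at h
    unfold stepInt stepSlope
    simp only [Bool.false_eq_true, if_false]
    exact h.congr_deriv (by ring)
  · have h := (hasDerivAt_max_sq (1 / 4) t).sub (hasDerivAt_max_sq (3 / 4) t)
    unfold stepInt stepSlope
    simp only [if_true]
    exact h.congr_deriv (by ring)

theorem continuous_stepSlope (k : Bool) : Continuous (stepSlope k) := by
  cases k <;> unfold stepSlope <;> simp only [Bool.false_eq_true, if_false, if_true] <;> fun_prop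

theorem stepSlope_of_nonpos (k : Bool) {t : ℝ} (ht : t ≤ 0) : stepSlope k t = 0 := by
  cases k <;> simp only [stepSlope, Bool.false_eq_true, if_false, if_true]
  · rw [max_eq_right ht, max_eq_right (by linarith)]; simp
  · rw [max_eq_right (by linarith), max_eq_right (by linarith)]; simp

theorem stepSlope_of_one_le (k : Bool) {t : ℝ} (ht : 1 ≤ t) : stepSlope k t = 1 := by
  cases k <;> simp only [stepSlope, Bool.false_eq_true, if_false, if_true]
  · rw [max_eq_left (by linarith), max_eq_left (by linarith)]; ring
  · rw [max_eq_left (by linarith), max_eq_left (by linarith)]; ring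

theorem ramp_mono {c d x y : ℝ} (hcd : c ≤ d) (hxy : x ≤ y) :
    max (x - c) 0 - max (x - d) 0 ≤ max (y - c) 0 - max (y - d) 0 := by
  rcases max_cases (x - c) 0 with ⟨e1, _⟩ | ⟨e1, _⟩ <;>
    rcases max_cases (x - d) 0 with ⟨e2, _⟩ | ⟨e2, _⟩ <;>
    rcases max_cases (y - c) 0 with ⟨e3, _⟩ | ⟨e3, _⟩ <;>
    rcases max_cases (y - d) 0 with ⟨e4, _⟩ | ⟨e4, _⟩ <;> rw [e1, e2, e3, e4] <;> linarith

theorem stepSlope_mono (k : Bool) : Monotone (stepSlope k) := by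
  intro x y hxy
  cases k <;> simp only [stepSlope, Bool.false_eq_true, if_false, if_true]
  · simpa using ramp_mono zero_le_one hxy
  · exact mul_le_mul_of_nonneg_left (ramp_mono (by norm_num) hxy) zero_le_two

theorem stepSlope_nonneg (k : Bool) (t : ℝ) : 0 ≤ stepSlope k t := by
  rcases le_total t 0 with h | h
  · rw [stepSlope_of_nonpos k h]
  · have := stepSlope_mono k h
    rwa [stepSlope_of_nonpos k le_rfl] at this

theorem stepSlope_le_one (k : Bool) (t : ℝ) : stepSlope k t ≤ 1 := by
  rcases le_total t 1 with h | h
  · have := stepSlope_mono k h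
    rwa [stepSlope_of_one_le k le_rfl] at this
  · rw [stepSlope_of_one_le k h]

/-- The unit ramp is a sum of ramps over `[0, 1/4]`, `[1/4, 3/4]` and `[3/4, 1]`, and the steep
shape is twice the middle one. Both shapes are thus controlled by the unit ramp. -/
theorem stepSlope_sub_le (k : Bool) {x y : ℝ} (hxy : x ≤ y) :
    stepSlope k y - stepSlope k x ≤ 2 * (stepSlope false y - stepSlope false x) := by
  cases k
  · have := stepSlope_mono false hxy
    linarith
  · have h1 := ramp_mono (show (0 : ℝ) ≤ 1 / 4 by norm_num) hxy
    have h2 := ramp_mono (show (3 / 4 : ℝ) ≤ 1 by norm_num) hxy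
    simp only [stepSlope, Bool.false_eq_true, if_false, if_true]
    simp only [sub_zero] at h1
    linarith

theorem stepInt_of_nonpos (k : Bool) {t : ℝ} (ht : t ≤ 0) : stepInt k t = 0 := by
  cases k <;> simp only [stepInt, Bool.false_eq_true, if_false, if_true]
  · rw [max_eq_right ht, max_eq_right (by linarith)]; simp
  · rw [max_eq_right (by linarith), max_eq_right (by linarith)]; simp

/-- Both shapes are symmetric about `1 / 2`, so they leave the same potential behind. This is what
confines the effect of a bit to its own step. -/
theorem stepInt_of_one_le (k : Bool) {t : ℝ} (ht : 1 ≤ t) : stepInt k t = t - 1 / 2 := by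
  cases k <;> simp only [stepInt, Bool.false_eq_true, if_false, if_true]
  · rw [max_eq_left (by linarith), max_eq_left (by linarith)]; ring
  · rw [max_eq_left (by linarith), max_eq_left (by linarith)]; ring

theorem stepInt_nonneg (k : Bool) (t : ℝ) : 0 ≤ stepInt k t := by
  cases k <;> simp only [stepInt, Bool.false_eq_true, if_false, if_true, max_def] <;>
    split_ifs <;> nlinarith

theorem stepInt_le (k : Bool) (t : ℝ) : stepInt k t ≤ max t 0 := by
  cases k <;> simp only [stepInt, Bool.false_eq_true, if_false, if_true, max_def] <;>
    split_ifs <;> nlinarith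

theorem le_stepInt (k : Bool) (t : ℝ) : t - 1 ≤ stepInt k t := by
  rcases le_total t 1 with h | h
  · linarith [stepInt_nonneg k t]
  · rw [stepInt_of_one_le k h]; linarith

theorem abs_stepInt_sub_le (k l : Bool) {t : ℝ} (ht : t ≤ 1) : |stepInt k t - stepInt l t| ≤ 1 := by
  have h1 := stepInt_le k t
  have h2 := stepInt_le l t
  have h3 := stepInt_nonneg k t
  have h4 := stepInt_nonneg l t
  have : max t 0 ≤ 1 := max_le ht zero_le_one
  rw [abs_le]; constructor <;> linarith

theorem stepSlope_true_sub_false {t : ℝ} (h0 : 1 / 8 ≤ t) (h1 : t ≤ 1 / 4) :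
    1 / 8 ≤ |stepSlope true t - stepSlope false t| := by
  have e1 : stepSlope true t = 0 := by
    simp only [stepSlope, if_true]
    rw [max_eq_right (by linarith), max_eq_right (by linarith)]; simp
  have e2 : stepSlope false t = t := by
    simp only [stepSlope, Bool.false_eq_true, if_false]
    rw [max_eq_left (by linarith), max_eq_right (by linarith)]; simp
  rw [e1, e2, zero_sub, abs_neg]
  exact h0.trans (le_abs_self t)

/-! ### Staircase slopes and potentials. -/

/-- A staircase with `m` steps of height `1 / (16 m)`, the `j`-th one on `[j / m, j / m + h]` with
shape `w j`. -/
noncomputable def stairSlope (m : ℕ) (h : ℝ) (w : Fin m → Bool) (t : ℝ) : ℝ :=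
  ∑ j : Fin m, 1 / (16 * m) * stepSlope (w j) ((t - j / m) / h)

/-- The antiderivative of `stairSlope m h w` that vanishes on the negative half-line. -/
noncomputable def stair (m : ℕ) (h : ℝ) (w : Fin m → Bool) (t : ℝ) : ℝ :=
  ∑ j : Fin m, 1 / (16 * m) * (h * stepInt (w j) ((t - j / m) / h))

section Stair

variable {m : ℕ} {h : ℝ} (w : Fin m → Bool)

theorem hasDerivAt_stair (hh : 0 < h) (t : ℝ) :
    HasDerivAt (stair m h w) (stairSlope m h w t) t := by
  unfold stair stairSlope
  refine HasDerivAt.fun_sum fun j _ => HasDerivAt.const_mul _ ?_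
  have h1 : HasDerivAt (fun x : ℝ => (x - j / m) / h) (1 / h) t :=
    ((hasDerivAt_id t).sub_const _).div_const h
  have h2 := ((hasDerivAt_stepInt (w j) ((t - j / m) / h)).comp t h1).const_mul h
  exact h2.congr_deriv (by field_simp)

theorem continuous_stairSlope : Continuous (stairSlope m h w) := by
  unfold stairSlope
  refine continuous_finsetSum _ fun j _ => continuous_const.mul ?_
  exact (continuous_stepSlope _).comp (by fun_prop)

theorem stairSlope_mono (hh : 0 < h) : Monotone (stairSlope m h w) := by
  intro x y hxy
  unfold stairSlope
  gcongr
  exact stepSlope_mono _ (by gcongr)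

theorem stairSlope_nonneg (t : ℝ) : 0 ≤ stairSlope m h w t :=
  Finset.sum_nonneg fun j _ => mul_nonneg (by positivity) (stepSlope_nonneg _ _)

theorem sum_const_step (hm : 0 < m) (c : ℝ) : ∑ _j : Fin m, 1 / (16 * (m : ℝ)) * c = c / 16 := by
  have : (m : ℝ) ≠ 0 := by positivity
  rw [Finset.sum_const, Finset.card_univ, Fintype.card_fin, nsmul_eq_mul]
  field_simp

theorem stairSlope_le (hm : 0 < m) (t : ℝ) : stairSlope m h w t ≤ 1 / 16 := by
  rw [← sum_const_step hm 1]
  unfold stairSlope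
  gcongr
  exact stepSlope_le_one _ _

theorem stair_nonneg (hh : 0 < h) (t : ℝ) : 0 ≤ stair m h w t :=
  Finset.sum_nonneg fun j _ => mul_nonneg (by positivity) (mul_nonneg hh.le (stepInt_nonneg _ _))

theorem stairSlope_of_nonpos (hh : 0 < h) {t : ℝ} (ht : t ≤ 0) : stairSlope m h w t = 0 := by
  refine Finset.sum_eq_zero fun j _ => ?_
  rw [stepSlope_of_nonpos, mul_zero]
  exact div_nonpos_of_nonpos_of_nonneg (by have : (0 : ℝ) ≤ j / m := by positivity
                                           linarith) hh.le

theorem stair_of_nonpos (hh : 0 < h) {t : ℝ} (ht : t ≤ 0) : stair m h w t = 0 := by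
  refine Finset.sum_eq_zero fun j _ => ?_
  rw [stepInt_of_nonpos, mul_zero, mul_zero]
  exact div_nonpos_of_nonpos_of_nonneg (by have : (0 : ℝ) ≤ j / m := by positivity
                                           linarith) hh.le

theorem step_end_le_one (hhm : h ≤ 1 / m) (j : Fin m) : (j : ℝ) / m + h ≤ 1 := by
  have hm : (0 : ℝ) < m := by exact_mod_cast j.pos
  have : ((j : ℕ) : ℝ) + 1 ≤ m := by exact_mod_cast j.2
  calc (j : ℝ) / m + h ≤ j / m + 1 / m := by gcongr
    _ = (j + 1) / m := by ring
    _ ≤ 1 := (div_le_one hm).2 this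

/-- All steps are completed by `1`, after which the slope is `1 / 16`; this linear growth yields the
exponential tails. -/
theorem le_stair (hm : 0 < m) (hh : 0 < h) (hhm : h ≤ 1 / m) (t : ℝ) :
    (t - 1) / 16 ≤ stair m h w t := by
  rw [← sum_const_step hm (t - 1)]
  unfold stair
  gcongr with j
  have h1 := le_stepInt (w j) ((t - j / m) / h)
  have h2 := mul_le_mul_of_nonneg_left h1 hh.le
  have h3 : h * ((t - j / m) / h - 1) = t - (j / m + h) := by field_simp; ring
  have := step_end_le_one hhm j
  linarith

theorem stair_le (hm : 0 < m) (hh : 0 < h) {t : ℝ} (h1 : t ≤ 1) :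
    stair m h w t ≤ 1 / 16 := by
  rw [← sum_const_step hm 1]
  unfold stair
  gcongr with j
  refine (mul_le_mul_of_nonneg_left (stepInt_le _ _) hh.le).trans ?_
  rw [mul_max_of_nonneg _ _ hh.le, mul_zero, mul_div_cancel₀ _ hh.ne']
  have : (0 : ℝ) ≤ j / m := by positivity
  exact max_le (by linarith) zero_le_one

/-- On the `j`-th period the staircase only depends on the shape of the `j`-th step. -/
theorem step_arg_cases (hh : 0 < h) (hhm : h ≤ 1 / m) {t : ℝ} {i j : Fin m}
    (h0 : (j : ℝ) / m ≤ t) (h1 : t ≤ (j + 1) / m) (hij : i ≠ j) :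
    (t - i / m) / h ≤ 0 ∨ 1 ≤ (t - i / m) / h := by
  have hm : (0 : ℝ) < m := by exact_mod_cast j.pos
  rcases lt_or_gt_of_ne hij with hlt | hlt
  · right
    rw [le_div_iff₀ hh]
    have : (((i : ℕ) : ℝ) + 1) / m ≤ j / m := by
      gcongr
      exact_mod_cast hlt
    rw [add_div] at this
    linarith
  · left
    refine div_nonpos_of_nonpos_of_nonneg ?_ hh.le
    have : (((j : ℕ) : ℝ) + 1) / m ≤ i / m := by
      gcongr
      exact_mod_cast hlt
    linarith

theorem stairSlope_eq_const (hh : 0 < h) (hhm : h ≤ 1 / m) {t : ℝ} (j : Fin m)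
    (h0 : (j : ℝ) / m ≤ t) (h1 : t ≤ (j + 1) / m) :
    stairSlope m h w t = stairSlope m h (fun _ => w j) t := by
  refine Finset.sum_congr rfl fun i _ => ?_
  by_cases hij : i = j
  · rw [hij]
  · rcases step_arg_cases hh hhm h0 h1 hij with e | e
    · rw [stepSlope_of_nonpos _ e, stepSlope_of_nonpos _ e]
    · rw [stepSlope_of_one_le _ e, stepSlope_of_one_le _ e]

theorem stair_eq_const (hh : 0 < h) (hhm : h ≤ 1 / m) {t : ℝ} (j : Fin m)
    (h0 : (j : ℝ) / m ≤ t) (h1 : t ≤ (j + 1) / m) :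
    stair m h w t = stair m h (fun _ => w j) t := by
  refine Finset.sum_congr rfl fun i _ => ?_
  by_cases hij : i = j
  · rw [hij]
  · rcases step_arg_cases hh hhm h0 h1 hij with e | e
    · rw [stepInt_of_nonpos _ e, stepInt_of_nonpos _ e]
    · rw [stepInt_of_one_le _ e, stepInt_of_one_le _ e]

theorem stair_eq_of_one_le (hh : 0 < h) (hhm : h ≤ 1 / m) {t : ℝ} (ht : 1 ≤ t)
    (w' : Fin m → Bool) : stair m h w t = stair m h w' t := by
  refine Finset.sum_congr rfl fun i _ => ?_
  have e : 1 ≤ (t - i / m) / h := by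
    rw [le_div_iff₀ hh]
    linarith [step_end_le_one hhm i]
  rw [stepInt_of_one_le _ e, stepInt_of_one_le _ e]

theorem exists_period (hm : 0 < m) {t : ℝ} (h0 : 0 ≤ t) (h1 : t < 1) :
    ∃ j : Fin m, (j : ℝ) / m ≤ t ∧ t ≤ (j + 1) / m := by
  have hm' : (0 : ℝ) < m := by exact_mod_cast hm
  have hlt : ⌊t * m⌋₊ < m := (Nat.floor_lt (by positivity)).2 (by nlinarith)
  refine ⟨⟨⌊t * m⌋₊, hlt⟩, ?_, ?_⟩
  · rw [div_le_iff₀ hm']; exact Nat.floor_le (by positivity)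
  · rw [le_div_iff₀ hm']; exact (Nat.lt_floor_add_one _).le

/-- On each period one of the two staircases has shape `false` and the other shape `true`, so the
unordered pair of values is independent of `w`; outside the unit interval the shapes are irrelevant.
-/
theorem map_stair_add_compl (hm : 0 < m) (hh : 0 < h) (hhm : h ≤ 1 / m) (F : ℝ → ℝ) (t : ℝ) :
    F (stair m h w t) + F (stair m h (fun j => !w j) t)
      = F (stair m h (fun _ => false) t) + F (stair m h (fun _ => true) t) := by
  rcases le_or_gt 1 t with h1 | h1
  · rw [stair_eq_of_one_le w hh hhm h1 fun _ => false,
      stair_eq_of_one_le (fun j => !w j) hh hhm h1 fun _ => true]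
  rcases le_or_gt t 0 with h0 | h0
  · simp only [stair_of_nonpos _ hh h0]
  obtain ⟨j, hj0, hj1⟩ := exists_period hm h0.le h1
  rw [stair_eq_const w hh hhm j hj0 hj1, stair_eq_const (fun j => !w j) hh hhm j hj0 hj1]
  cases w j
  · rfl
  · exact add_comm _ _

theorem abs_stair_sub_le (hh : 0 < h) (hhm : h ≤ 1 / m) (w' : Fin m → Bool) {t : ℝ} (j : Fin m)
    (h0 : (j : ℝ) / m ≤ t) (h1 : t ≤ j / m + h) :
    |stair m h w t - stair m h w' t| ≤ 1 / (16 * m) * h := by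
  have h1' : t ≤ (j + 1) / m := by rw [add_div]; linarith
  unfold stair
  rw [← Finset.sum_sub_distrib, Finset.sum_eq_single_of_mem j (Finset.mem_univ j)]
  · rw [← mul_sub, ← mul_sub, abs_mul, abs_mul, abs_of_pos hh,
      abs_of_nonneg (show (0 : ℝ) ≤ 1 / (16 * m) by positivity)]
    refine mul_le_mul_of_nonneg_left ?_ (by positivity)
    refine mul_le_of_le_one_right hh.le (abs_stepInt_sub_le _ _ ?_)
    rw [div_le_one hh]
    linarith
  · intro i _ hij
    rcases step_arg_cases hh hhm h0 h1' hij with e | e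
    · rw [stepInt_of_nonpos _ e, stepInt_of_nonpos _ e, sub_self]
    · rw [stepInt_of_one_le _ e, stepInt_of_one_le _ e, sub_self]

/-- A point sees the discrepancy of a single step only. The bound is written as a sum over differing
bits so that integration produces the Hamming distance. -/
theorem stair_sub_sq_le (hm : 0 < m) (hh : 0 < h) (hhm : h ≤ 1 / m) (w' : Fin m → Bool) (t : ℝ) :
    (stair m h w t - stair m h w' t) ^ 2
      ≤ ∑ j with w j ≠ w' j, (Icc ((j : ℝ) / m) (j / m + h)).indicator
          (fun _ => (1 / (16 * (m : ℝ)) * h) ^ 2) t := by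
  have hnn : 0 ≤ ∑ j with w j ≠ w' j, (Icc ((j : ℝ) / m) (j / m + h)).indicator
      (fun _ => (1 / (16 * (m : ℝ)) * h) ^ 2) t :=
    Finset.sum_nonneg fun j _ => indicator_nonneg (fun _ _ => by positivity) _
  by_cases hex : ∃ j, w j ≠ w' j ∧ t ∈ Icc ((j : ℝ) / m) (j / m + h)
  · obtain ⟨j, hj, ht⟩ := hex
    refine le_trans ?_ (Finset.single_le_sum
      (fun j _ => indicator_nonneg (fun _ _ => by positivity) _)
      (Finset.mem_filter.2 ⟨Finset.mem_univ j, hj⟩))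
    rw [indicator_of_mem ht]
    exact sq_le_sq' (neg_le_of_abs_le (abs_stair_sub_le w hh hhm w' j ht.1 ht.2))
      (le_of_abs_le (abs_stair_sub_le w hh hhm w' j ht.1 ht.2))
  · have : stair m h w t = stair m h w' t := by
      refine Finset.sum_congr rfl fun i _ => ?_
      by_cases hi : w i = w' i
      · rw [hi]
      · have hn : ¬ t ∈ Icc ((i : ℝ) / m) (i / m + h) := fun hc => hex ⟨i, hi, hc⟩
        rw [mem_Icc, not_and_or, not_le, not_le] at hn
        rcases hn with e | e
        · have e' : (t - i / m) / h ≤ 0 := div_nonpos_of_nonpos_of_nonneg (by linarith) hh.le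
          rw [stepInt_of_nonpos _ e', stepInt_of_nonpos _ e']
        · have e' : 1 ≤ (t - i / m) / h := by rw [le_div_iff₀ hh]; linarith
          rw [stepInt_of_one_le _ e', stepInt_of_one_le _ e']
    rw [this, sub_self]
    simpa using hnn

theorem stairSlope_sep (hh : 0 < h) (hhm : h ≤ 1 / m) {t : ℝ} (j : Fin m)
    (h0 : (j : ℝ) / m + h / 8 ≤ t) (h1 : t ≤ j / m + h / 4) :
    1 / (128 * (m : ℝ)) ≤ |stairSlope m h (fun _ => true) t - stairSlope m h (fun _ => false) t| := by
  have h1' : t ≤ (j + 1) / m := by rw [add_div]; linarith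
  unfold stairSlope
  rw [← Finset.sum_sub_distrib, Finset.sum_eq_single_of_mem j (Finset.mem_univ j)]
  · rw [← mul_sub, abs_mul, abs_of_nonneg (show (0 : ℝ) ≤ 1 / (16 * m) by positivity)]
    have := stepSlope_true_sub_false (t := (t - j / m) / h)
      (by rw [le_div_iff₀ hh]; linarith) (by rw [div_le_iff₀ hh]; linarith)
    calc 1 / (128 * (m : ℝ)) = 1 / (16 * m) * (1 / 8) := by ring
      _ ≤ _ := by gcongr
  · intro i _ hij
    rcases step_arg_cases hh hhm (by linarith) h1' hij with e | e
    · rw [stepSlope_of_nonpos _ e, stepSlope_of_nonpos _ e, sub_self]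
    · rw [stepSlope_of_one_le _ e, stepSlope_of_one_le _ e, sub_self]

/-! ### Modulus of continuity of the staircase. -/

/-- The contiguous ramps of width `1 / m` add up to the ramp of width `1`. -/
theorem sum_ramp_eq (hm : 0 < m) (t : ℝ) :
    ∑ j : Fin m, (max (t - (j : ℝ) / m) 0 - max (t - ((j : ℝ) + 1) / m) 0)
      = max t 0 - max (t - 1) 0 := by
  have hm' : (m : ℝ) ≠ 0 := by positivity
  have := Fin.sum_univ_eq_sum_range
    (fun j : ℕ => max (t - (j : ℝ) / m) 0 - max (t - ((j : ℝ) + 1) / m) 0) m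
  rw [this]
  have h2 := Finset.sum_range_sub' (fun j : ℕ => max (t - (j : ℝ) / m) 0) m
  simp only [Nat.cast_add, Nat.cast_one] at h2
  rw [h2]
  simp [hm']

theorem ramp_sub_le {d x y : ℝ} (hd : 0 ≤ d) (hxy : x ≤ y) :
    (max y 0 - max (y - d) 0) - (max x 0 - max (x - d) 0) ≤ y - x := by
  have h1 := max_cases y 0
  have h2 := max_cases x 0
  have h3 := max_cases (y - d) 0
  have h4 := max_cases (x - d) 0
  rcases h1 with ⟨e1, _⟩ | ⟨e1, _⟩ <;> rcases h2 with ⟨e2, _⟩ | ⟨e2, _⟩ <;>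
    rcases h3 with ⟨e3, _⟩ | ⟨e3, _⟩ <;> rcases h4 with ⟨e4, _⟩ | ⟨e4, _⟩ <;>
    rw [e1, e2, e3, e4] <;> linarith

/-- Each step rises at most `2 / h` times as fast as the ramp over its period, and these ramps add
up to a single ramp of slope `1`. The sum over steps therefore costs no factor `m`. -/
theorem stairSlope_sub_le_lipschitz (hm : 0 < m) (hh : 0 < h) (hhm : h ≤ 1 / m) {x y : ℝ}
    (hxy : x ≤ y) :
    stairSlope m h w y - stairSlope m h w x ≤ 1 / (8 * m) * ((y - x) / h) := by
  have hm' : (0 : ℝ) < m := by positivity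
  have key : ∀ j : Fin m, stepSlope (w j) ((y - j / m) / h) - stepSlope (w j) ((x - j / m) / h)
      ≤ 2 / h * ((max (y - (j : ℝ) / m) 0 - max (y - ((j : ℝ) + 1) / m) 0)
        - (max (x - (j : ℝ) / m) 0 - max (x - ((j : ℝ) + 1) / m) 0)) := by
    intro j
    have h1 : (x - j / m) / h ≤ (y - j / m) / h := by gcongr
    refine (stepSlope_sub_le (w j) h1).trans ?_
    have e : ∀ t : ℝ, stepSlope false (t / h) = 1 / h * (max t 0 - max (t - h) 0) := by
      intro t
      simp only [stepSlope, Bool.false_eq_true, if_false]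
      rw [mul_sub, mul_max_of_nonneg _ _ (by positivity), mul_max_of_nonneg _ _ (by positivity),
        mul_zero]
      congr 2
      · ring
      · field_simp
    rw [e, e]
    have : ∀ a b : ℝ, a ≤ b → (max b 0 - max (b - h) 0) - (max a 0 - max (a - h) 0)
        ≤ (max b 0 - max (b - 1 / m) 0) - (max a 0 - max (a - 1 / m) 0) := by
      intro a b hab
      linarith [ramp_mono hhm hab]
    have h2 := this (x - j / m) (y - j / m) (by linarith)
    have e2 : ∀ t : ℝ, t - ((j : ℝ) + 1) / m = t - j / m - 1 / m := fun t => by ring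
    rw [e2, e2]
    calc 2 * (1 / h * (max (y - j / m) 0 - max (y - j / m - h) 0)
          - 1 / h * (max (x - j / m) 0 - max (x - j / m - h) 0))
        = 2 / h * ((max (y - j / m) 0 - max (y - j / m - h) 0)
          - (max (x - j / m) 0 - max (x - j / m - h) 0)) := by ring
      _ ≤ _ := by gcongr
  unfold stairSlope
  rw [← Finset.sum_sub_distrib]
  calc _ ≤ ∑ j : Fin m, 1 / (16 * (m : ℝ)) * (2 / h *
        ((max (y - (j : ℝ) / m) 0 - max (y - ((j : ℝ) + 1) / m) 0)
        - (max (x - (j : ℝ) / m) 0 - max (x - ((j : ℝ) + 1) / m) 0))) := by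
        refine Finset.sum_le_sum fun j _ => ?_
        rw [← mul_sub]
        exact mul_le_mul_of_nonneg_left (key j) (by positivity)
    _ = 1 / (16 * (m : ℝ)) * (2 / h * ((max y 0 - max (y - 1) 0) - (max x 0 - max (x - 1) 0))) := by
        rw [← Finset.mul_sum, ← Finset.mul_sum, Finset.sum_sub_distrib, sum_ramp_eq hm,
          sum_ramp_eq hm]
    _ ≤ 1 / (16 * (m : ℝ)) * (2 / h * (y - x)) := by
        exact mul_le_mul_of_nonneg_left (mul_le_mul_of_nonneg_left
          (ramp_sub_le zero_le_one hxy) (by positivity)) (by positivity)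
    _ = _ := by field_simp; ring

/-- The staircase lies between two copies of the ramp of slope `1 / 16`, shifted by one period to
the left and to the right. -/
theorem stairSlope_sub_le_coarse (hm : 0 < m) (hh : 0 < h) (hhm : h ≤ 1 / m) {x y : ℝ}
    (hxy : x ≤ y) :
    stairSlope m h w y - stairSlope m h w x ≤ 1 / 16 * (y - x + 2 / m) := by
  have hm' : (0 : ℝ) < m := by positivity
  have hup : ∀ j : Fin m, stepSlope (w j) ((y - j / m) / h)
      ≤ m * (max (y + 1 / m - (j : ℝ) / m) 0 - max (y + 1 / m - ((j : ℝ) + 1) / m) 0) := by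
    intro j
    rw [add_div, show y + 1 / (m : ℝ) - (j / m + 1 / m) = y - j / m by ring,
      show y + 1 / (m : ℝ) - j / m = y - j / m + 1 / m by ring]
    generalize y - (j : ℝ) / m = z
    rcases le_total z 0 with hz | hz
    · rw [stepSlope_of_nonpos _ (div_nonpos_of_nonpos_of_nonneg hz hh.le), max_eq_right hz, sub_zero]
      positivity
    · refine (stepSlope_le_one _ _).trans ?_
      rw [max_eq_left hz, max_eq_left (by positivity)]
      refine le_of_eq ?_
      field_simp
      ring
  have hlo : ∀ j : Fin m,
      m * (max (x - 1 / m - (j : ℝ) / m) 0 - max (x - 1 / m - ((j : ℝ) + 1) / m) 0)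
      ≤ stepSlope (w j) ((x - j / m) / h) := by
    intro j
    rw [add_div, show x - 1 / (m : ℝ) - (j / m + 1 / m) = x - j / m - 1 / m - 1 / m by ring,
      show x - 1 / (m : ℝ) - j / m = x - j / m - 1 / m by ring]
    generalize x - (j : ℝ) / m = z
    rcases le_total z h with hz | hz
    · rw [max_eq_right (by linarith), max_eq_right (by
        have : (0 : ℝ) < 1 / m := by positivity
        linarith)]
      simpa using stepSlope_nonneg _ _
    · rw [stepSlope_of_one_le _ ((one_le_div hh).2 hz)]
      have : max (z - 1 / m) 0 - max (z - 1 / m - 1 / m) 0 ≤ 1 / (m : ℝ) := by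
        have : (0 : ℝ) < 1 / m := by positivity
        simp only [max_def]; split_ifs <;> linarith
      calc _ ≤ (m : ℝ) * (1 / m) := by gcongr
        _ = 1 := by field_simp
  have hy : stairSlope m h w y
      ≤ 1 / 16 * (max (y + 1 / m) 0 - max (y + 1 / m - 1) 0) := by
    unfold stairSlope
    rw [← sum_ramp_eq hm, Finset.mul_sum]
    refine Finset.sum_le_sum fun j _ => ?_
    refine (mul_le_mul_of_nonneg_left (hup j) (by positivity)).trans_eq ?_
    field_simp
  have hx : 1 / 16 * (max (x - 1 / m) 0 - max (x - 1 / m - 1) 0) ≤ stairSlope m h w x := by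
    unfold stairSlope
    rw [← sum_ramp_eq hm, Finset.mul_sum]
    refine Finset.sum_le_sum fun j _ => ?_
    refine le_trans (le_of_eq ?_) (mul_le_mul_of_nonneg_left (hlo j) (by positivity))
    field_simp
  have h1m : (0 : ℝ) < 1 / m := by positivity
  have h3 := ramp_sub_le (d := 1) zero_le_one (show x - 1 / (m : ℝ) ≤ y + 1 / m by linarith)
  have : y - x + 2 / (m : ℝ) = (y + 1 / m) - (x - 1 / m) := by ring
  rw [this]
  linarith

/-- Three scales: below `h` the Lipschitz bound applies, with `1 / m` at most `2 h ^ γ`; between `h`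
and `1` the coarse bound; beyond `1` the total height `1 / 16` suffices. -/
theorem abs_stairSlope_sub_le (hm : 0 < m) (hh : 0 < h) (hhm : h ≤ 1 / m) {γ : ℝ} (hγ0 : 0 ≤ γ)
    (hγ1 : γ ≤ 1) (hmγ : 1 / (m : ℝ) ≤ 2 * h ^ γ) (x y : ℝ) :
    |stairSlope m h w x - stairSlope m h w y| ≤ 1 / 2 * |x - y| ^ γ := by
  wlog hxy : y ≤ x generalizing x y
  · rw [abs_sub_comm, abs_sub_comm x]
    exact this y x (le_of_not_ge hxy)
  rw [abs_of_nonneg (sub_nonneg.2 (stairSlope_mono w hh hxy)), abs_of_nonneg (sub_nonneg.2 hxy)]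
  have h1 := stairSlope_sub_le_lipschitz w hm hh hhm hxy
  have h2 := stairSlope_sub_le_coarse w hm hh hhm hxy
  have h3 : stairSlope m h w x - stairSlope m h w y ≤ 1 / 16 := by
    linarith [stairSlope_le w (h := h) hm x, stairSlope_nonneg w (h := h) y]
  have he0 : 0 ≤ x - y := sub_nonneg.2 hxy
  generalize x - y = e at *
  rcases eq_or_lt_of_le he0 with he | he
  · rw [← he] at h1 ⊢
    simp only [zero_div, mul_zero] at h1
    have := Real.rpow_nonneg (le_refl (0 : ℝ)) γ
    linarith
  rcases le_or_gt 1 e with h1e | h1e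
  · have := Real.one_le_rpow h1e hγ0
    linarith
  rcases le_or_gt e h with heh | heh
  · have h4 : e / h ≤ (e / h) ^ γ :=
      Real.self_le_rpow_of_le_one (by positivity) ((div_le_one hh).2 heh) hγ1
    rw [Real.div_rpow he.le hh.le] at h4
    have h5 : (0 : ℝ) < h ^ γ := by positivity
    calc _ ≤ 1 / (8 * (m : ℝ)) * (e / h) := h1
      _ = 1 / 8 * (1 / m) * (e / h) := by ring
      _ ≤ 1 / 8 * (2 * h ^ γ) * (e ^ γ / h ^ γ) := by gcongr
      _ = 1 / 4 * e ^ γ := by field_simp; norm_num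
      _ ≤ _ := by gcongr; norm_num
  · have h4 : e ≤ e ^ γ := Real.self_le_rpow_of_le_one he.le h1e.le hγ1
    have h5 : h ^ γ ≤ e ^ γ := by gcongr
    have h6 : 2 / (m : ℝ) = 2 * (1 / m) := by ring
    rw [h6] at h2
    linarith

end Stair

/-! ### Scores and class membership for positive densities with differentiable logarithm. -/

section SmoothDensity

variable {f ψ : ℝ → ℝ}

theorem leftLogDeriv_eq {x d : ℝ} (hd : HasDerivAt (fun t => Real.log (f t)) d x) :
    leftLogDeriv f x = d :=
  hd.hasDerivWithinAt.derivWithin (uniqueDiffWithinAt_Iio x)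

theorem rightLogDeriv_eq {x d : ℝ} (hd : HasDerivAt (fun t => Real.log (f t)) d x) :
    rightLogDeriv f x = d :=
  hd.hasDerivWithinAt.derivWithin (uniqueDiffWithinAt_Ioi x)

theorem score_eq_of_hasDerivAt (hpos : ∀ x, 0 < f x)
    (hd : ∀ x, HasDerivAt (fun t => Real.log (f t)) (ψ x) x) (x : ℝ) : score f x = (ψ x : EReal) := by
  rw [score, if_pos (hpos x), rightLogDeriv_eq (hd x)]

/-- The two one-sided derivatives coincide, so the score has a single version and the quantifier
over versions in `holderClass` is harmless. -/
theorem IsScore.eq_of_hasDerivAt (hpos : ∀ x, 0 < f x)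
    (hd : ∀ x, HasDerivAt (fun t => Real.log (f t)) (ψ x) x) {φ : ℝ → EReal} (h : IsScore f φ)
    (x : ℝ) : φ x = (ψ x : EReal) := by
  have h1 := h.right_le x (hpos x)
  have h2 := h.le_left x (hpos x)
  rw [rightLogDeriv_eq (hd x)] at h1
  rw [leftLogDeriv_eq (hd x)] at h2
  exact le_antisymm h2 h1

theorem loss_score_eq (hpos : ∀ x, 0 < f x)
    (hd : ∀ x, HasDerivAt (fun t => Real.log (f t)) (ψ x) x) (g : ℝ → ℝ) :
    loss f g (score f) = ∫⁻ x, ENNReal.ofReal ((g x - ψ x) ^ 2) * ENNReal.ofReal (f x) := by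
  refine lintegral_congr fun x => ?_
  rw [score_eq_of_hasDerivAt hpos hd, ← EReal.coe_sub, EReal.abs_def,
    ← ENNReal.ofReal_pow (abs_nonneg _), sq_abs]

theorem mem_holderFisherClass {β L r : ℝ} (hpos : ∀ x, 0 < f x) (hcont : Continuous f)
    (hint : ∫⁻ x, ENNReal.ofReal (f x) = 1)
    (hd : ∀ x, HasDerivAt (fun t => Real.log (f t)) (ψ x) x) (hanti : Antitone ψ)
    (hhol : ∀ x y, |ψ x - ψ y| ≤ L * |x - y| ^ (β - 1))
    (hfi : ∫⁻ x, ENNReal.ofReal (ψ x ^ 2 * f x) ≤ ENNReal.ofReal r) :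
    f ∈ holderFisherClass β L r := by
  have hu : {x | 0 < f x} = univ := eq_univ_of_forall hpos
  refine ⟨⟨⟨hcont, fun x => (hpos x).le, hint, ?_⟩, fun φ hφ x y => ?_⟩, ?_⟩
  · rw [hu]
    refine Antitone.concaveOn_univ_of_deriv (fun x => (hd x).differentiableAt) ?_
    rwa [show deriv (fun t => Real.log (f t)) = ψ from funext fun x => (hd x).deriv]
  · rw [hφ.eq_of_hasDerivAt hpos hd, hφ.eq_of_hasDerivAt hpos hd, ← EReal.coe_sub, EReal.abs_def]
    exact ENNReal.ofReal_le_ofReal (hhol x y)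
  · refine le_of_eq_of_le (lintegral_congr fun x => ?_) hfi
    rw [score_eq_of_hasDerivAt hpos hd, EReal.abs_def, ← ENNReal.ofReal_pow (abs_nonneg _), sq_abs,
      ← ENNReal.ofReal_mul (sq_nonneg _)]

end SmoothDensity

/-! ### Folding, scaling and exponential estimates. -/

theorem lintegral_eq_lintegral_Ioi_add_neg {F : ℝ → ℝ≥0∞} (hF : Measurable F) :
    ∫⁻ x, F x = ∫⁻ x in Ioi 0, (F x + F (-x)) := by
  rw [lintegral_add_left hF, ← lintegral_add_compl F (measurableSet_Ioi (a := (0 : ℝ))), compl_Ioi,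
    setLIntegral_congr Iio_ae_eq_Iic.symm]
  congr 1
  have h := (Measure.measurePreserving_neg (volume : Measure ℝ)).setLIntegral_comp_preimage
    (measurableSet_Iio (a := (0 : ℝ))) hF
  rw [← h]
  simp

theorem lintegral_comp_mul_left_of_pos {F : ℝ → ℝ≥0∞} (hF : Measurable F) {a : ℝ} (ha : 0 < a) :
    ∫⁻ x, F (a * x) = ENNReal.ofReal (1 / a) * ∫⁻ x, F x := by
  have h := lintegral_map (μ := volume) hF (measurable_const_mul a)
  rw [← h, Real.map_volume_mul_left ha.ne', lintegral_smul_measure, abs_of_pos (by positivity),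
    one_div, smul_eq_mul]

theorem setLIntegral_exp_tail_le (K : ℝ) :
    ∫⁻ x in Ioi K, ENNReal.ofReal (Real.exp ((1 - (x - K)) / 16)) ≤ ENNReal.ofReal 32 := by
  have e : ∀ x : ℝ, Real.exp ((1 - (x - K)) / 16)
      = Real.exp ((1 + K) / 16) * Real.exp (-(1 / 16) * x) := fun x => by
    rw [← Real.exp_add]; congr 1; ring
  have hI : IntegrableOn (fun x => Real.exp ((1 + K) / 16) * Real.exp (-(1 / 16) * x)) (Ioi K) :=
    (integrableOn_exp_mul_Ioi (by norm_num) K).const_mul _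
  simp_rw [e]
  rw [← ofReal_integral_eq_lintegral_ofReal hI (ae_of_all _ fun x => by positivity),
    integral_const_mul, integral_exp_mul_Ioi (by norm_num) K]
  refine ENNReal.ofReal_le_ofReal ?_
  have h1 : Real.exp ((1 + K) / 16) * (-Real.exp (-(1 / 16) * K) / -(1 / 16))
      = 16 * Real.exp (1 / 16) := by
    have : Real.exp (1 / 16) = Real.exp ((1 + K) / 16) * Real.exp (-(1 / 16) * K) := by
      rw [← Real.exp_add]; congr 1; ring
    rw [this]
    ring
  have h2 : Real.exp (1 / 16) ≤ 2 := by
    have := Real.exp_bound_div_one_sub_of_interval (x := 1 / 16) (by norm_num) (by norm_num)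
    linarith
  rw [h1]; linarith

theorem sq_exp_sub_exp_le {a b : ℝ} (ha : 0 ≤ a) (hb : 0 ≤ b) :
    (Real.exp (-a) - Real.exp (-b)) ^ 2 ≤ (a - b) ^ 2 := by
  wlog hab : a ≤ b generalizing a b
  · have := this hb ha (le_of_not_ge hab)
    nlinarith
  have h1 : Real.exp (-b) = Real.exp (-a) * Real.exp (a - b) := by
    rw [← Real.exp_add]; congr 1; ring
  have h2 := Real.add_one_le_exp (a - b)
  have h3 : Real.exp (-a) ≤ 1 := Real.exp_le_one_iff.2 (by linarith)
  have h4 : Real.exp (a - b) ≤ 1 := Real.exp_le_one_iff.2 (by linarith)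
  have h5 := Real.exp_pos (-a)
  rw [← neg_sub b a, neg_sq]
  refine sq_le_sq' ?_ ?_ <;> rw [h1] <;> nlinarith

/-! ### Unnormalised densities: mass, Fisher information, Hellinger distance. -/

section Profile

/-- An unnormalised density with a plateau on `[-K, K]`, whose log-density falls off like the
staircase potential on the right and like the one with complementary shapes on the left. -/
noncomputable def profile (K : ℝ) (m : ℕ) (h : ℝ) (w : Fin m → Bool) (x : ℝ) : ℝ :=
  Real.exp (-(stair m h w (x - K) + stair m h (fun j => !w j) (-x - K)))

variable {K : ℝ} {m : ℕ} {h : ℝ} (w : Fin m → Bool)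

theorem profile_pos (x : ℝ) : 0 < profile K m h w x := Real.exp_pos _

theorem continuous_stair (hh : 0 < h) : Continuous (stair m h w) :=
  continuous_iff_continuousAt.2 fun t => (hasDerivAt_stair w hh t).continuousAt

theorem continuous_profile (hh : 0 < h) : Continuous (profile K m h w) := by
  have h1 := continuous_stair w hh
  have h2 := continuous_stair (fun j => !w j) hh
  unfold profile
  fun_prop

theorem profile_of_nonneg (hK : 0 ≤ K) (hh : 0 < h) {x : ℝ} (hx : 0 ≤ x) :
    profile K m h w x = Real.exp (-stair m h w (x - K)) := by
  rw [profile, stair_of_nonpos (fun j => !w j) hh (by linarith), add_zero]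

theorem profile_neg (x : ℝ) : profile K m h w (-x) = profile K m h (fun j => !w j) x := by
  simp only [profile, Bool.not_not, neg_neg]
  rw [add_comm]

theorem lintegral_profile_eq (hK : 0 ≤ K) (hm : 0 < m) (hh : 0 < h) (hhm : h ≤ 1 / m) :
    ∫⁻ x, ENNReal.ofReal (profile K m h w x)
      = ∫⁻ x in Ioi 0, ENNReal.ofReal (profile K m h (fun _ => false) x
          + profile K m h (fun _ => true) x) := by
  rw [lintegral_eq_lintegral_Ioi_add_neg (continuous_profile w hh).measurable.ennreal_ofReal]
  refine setLIntegral_congr_fun measurableSet_Ioi fun x hx => ?_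
  have hx0 : 0 ≤ x := (mem_Ioi.1 hx).le
  rw [profile_neg, ← ENNReal.ofReal_add (profile_pos _ _).le (profile_pos _ _).le]
  simp only [profile_of_nonneg _ hK hh hx0]
  rw [map_stair_add_compl w hm hh hhm (fun y => Real.exp (-y))]

theorem profile_le_tail (hK : 0 ≤ K) (hm : 0 < m) (hh : 0 < h) (hhm : h ≤ 1 / m) {x : ℝ}
    (hx : 0 ≤ x) : profile K m h w x ≤ Real.exp ((1 - (x - K)) / 16) := by
  rw [profile_of_nonneg w hK hh hx, Real.exp_le_exp]
  linarith [le_stair w hm hh hhm (x - K)]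

theorem profile_le_one (hh : 0 < h) (x : ℝ) : profile K m h w x ≤ 1 := by
  rw [profile, Real.exp_le_one_iff]
  linarith [stair_nonneg w hh (x - K), stair_nonneg (fun j => !w j) hh (-x - K)]

theorem profile_of_plateau (hh : 0 < h) {x : ℝ} (h0 : -K ≤ x) (h1 : x ≤ K) :
    profile K m h w x = 1 := by
  rw [profile, stair_of_nonpos _ hh (by linarith), stair_of_nonpos _ hh (by linarith)]
  simp

theorem setLIntegral_profile_le (hK : 0 ≤ K) (hm : 0 < m) (hh : 0 < h) (hhm : h ≤ 1 / m) :
    ∫⁻ x in Ioi 0, ENNReal.ofReal (profile K m h w x) ≤ ENNReal.ofReal (K + 32) := by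
  rw [← Ioc_union_Ioi_eq_Ioi hK, lintegral_union measurableSet_Ioi
    (by rw [disjoint_left]; intro x hx hx'; exact absurd hx.2 (not_le.2 hx')),
    ENNReal.ofReal_add hK (by norm_num)]
  refine add_le_add ?_ (le_trans ?_ (setLIntegral_exp_tail_le K))
  · calc _ ≤ ∫⁻ x in Ioc 0 K, (1 : ℝ≥0∞) := by
          refine lintegral_mono fun x => ?_
          rw [← ENNReal.ofReal_one]
          exact ENNReal.ofReal_le_ofReal (profile_le_one w hh x)
      _ = _ := by simp
  · exact setLIntegral_mono' measurableSet_Ioi fun x hx => ENNReal.ofReal_le_ofReal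
      (profile_le_tail w hK hm hh hhm (hK.trans (mem_Ioi.1 hx).le))

theorem le_setLIntegral_profile (hh : 0 < h) :
    ENNReal.ofReal K ≤ ∫⁻ x in Ioi 0, ENNReal.ofReal (profile K m h w x) := by
  calc ENNReal.ofReal K = ∫⁻ x in Ioc 0 K, (1 : ℝ≥0∞) := by simp
    _ = ∫⁻ x in Ioc 0 K, ENNReal.ofReal (profile K m h w x) := by
      refine setLIntegral_congr_fun measurableSet_Ioc fun x hx => ?_
      rw [profile_of_plateau w hh (by linarith [hx.1, hx.2]) hx.2, ENNReal.ofReal_one]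
    _ ≤ _ := lintegral_mono_set Ioc_subset_Ioi_self

/-- The total mass of `profile K m h w`, which does not depend on `w`. -/
noncomputable def profileMass (K : ℝ) (m : ℕ) (h : ℝ) : ℝ :=
  (∫⁻ x in Ioi 0, ENNReal.ofReal (profile K m h (fun _ => false) x
          + profile K m h (fun _ => true) x)).toReal

/-- The plateau contributes `2 K` and the tails at most a constant. A mass of order `K` makes `K`
the parameter that tunes the Fisher information. -/
theorem profileMass_bounds (hK : 1 ≤ K) (hm : 0 < m) (hh : 0 < h) (hhm : h ≤ 1 / m) :
    (∀ w, ∫⁻ x, ENNReal.ofReal (profile K m h w x) = ENNReal.ofReal (profileMass K m h)) ∧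
      2 * K ≤ profileMass K m h ∧ profileMass K m h ≤ 66 * K := by
  have hK0 : 0 ≤ K := by linarith
  have hsplit : ∫⁻ x in Ioi 0, ENNReal.ofReal (profile K m h (fun _ => false) x
          + profile K m h (fun _ => true) x)
      = (∫⁻ x in Ioi 0, ENNReal.ofReal (profile K m h (fun _ => false) x))
        + ∫⁻ x in Ioi 0, ENNReal.ofReal (profile K m h (fun _ => true) x) := by
    rw [← lintegral_add_left (continuous_profile _ hh).measurable.ennreal_ofReal]
    exact lintegral_congr fun x => ENNReal.ofReal_add (profile_pos _ _).le (profile_pos _ _).le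
  have hup : ∫⁻ x in Ioi 0, ENNReal.ofReal (profile K m h (fun _ => false) x
          + profile K m h (fun _ => true) x) ≤ ENNReal.ofReal (66 * K) := by
    rw [hsplit]
    refine (add_le_add (setLIntegral_profile_le _ hK0 hm hh hhm)
      (setLIntegral_profile_le _ hK0 hm hh hhm)).trans ?_
    rw [← ENNReal.ofReal_add (by linarith) (by linarith)]
    exact ENNReal.ofReal_le_ofReal (by linarith)
  have hlo : ENNReal.ofReal (2 * K) ≤ ∫⁻ x in Ioi 0, ENNReal.ofReal
      (profile K m h (fun _ => false) x + profile K m h (fun _ => true) x) := by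
    rw [hsplit, two_mul, ENNReal.ofReal_add hK0 hK0]
    exact add_le_add (le_setLIntegral_profile _ hh) (le_setLIntegral_profile _ hh)
  have hne := ne_top_of_le_ne_top ENNReal.ofReal_ne_top hup
  refine ⟨fun w => ?_, ?_, ?_⟩
  · rw [lintegral_profile_eq w hK0 hm hh hhm, profileMass, ENNReal.ofReal_toReal hne]
  · exact (ENNReal.ofReal_le_iff_le_toReal hne).1 hlo
  · exact ENNReal.toReal_le_of_le_ofReal (by linarith) hup

/-- The derivative of `log (profile K m h w)`. -/
noncomputable def profileScore (K : ℝ) (m : ℕ) (h : ℝ) (w : Fin m → Bool) (x : ℝ) : ℝ :=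
  stairSlope m h (fun j => !w j) (-x - K) - stairSlope m h w (x - K)

theorem profileScore_neg (x : ℝ) :
    profileScore K m h w (-x) = -profileScore K m h (fun j => !w j) x := by
  simp only [profileScore, Bool.not_not, neg_neg]
  ring

theorem profileScore_of_nonneg (hK : 0 ≤ K) (hh : 0 < h) {x : ℝ} (hx : 0 ≤ x) :
    profileScore K m h w x = -stairSlope m h w (x - K) := by
  rw [profileScore, stairSlope_of_nonpos (fun j => !w j) hh (by linarith), zero_sub]

theorem hasDerivAt_log_profile (hh : 0 < h) (x : ℝ) :
    HasDerivAt (fun t => Real.log (profile K m h w t)) (profileScore K m h w x) x := by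
  simp only [profile, Real.log_exp]
  have h1 := (hasDerivAt_stair w hh (x - K)).comp x ((hasDerivAt_id x).sub_const K)
  have h2 := (hasDerivAt_stair (fun j => !w j) hh (-x - K)).comp x ((hasDerivAt_neg x).sub_const K)
  refine (h1.add h2).neg.congr_deriv ?_
  rw [profileScore]; ring

theorem profileScore_antitone (hh : 0 < h) : Antitone (profileScore K m h w) := by
  intro x y hxy
  have h1 := stairSlope_mono w hh (show x - K ≤ y - K by linarith)
  have h2 := stairSlope_mono (fun j => !w j) hh (show -y - K ≤ -x - K by linarith)
  simp only [profileScore]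
  linarith

theorem continuous_profileScore : Continuous (profileScore K m h w) := by
  have h1 := continuous_stairSlope (h := h) w
  have h2 := continuous_stairSlope (h := h) (fun j => !w j)
  unfold profileScore
  fun_prop

theorem abs_profileScore_sub_le (hm : 0 < m) (hh : 0 < h) (hhm : h ≤ 1 / m) {γ : ℝ} (hγ0 : 0 ≤ γ)
    (hγ1 : γ ≤ 1) (hmγ : 1 / (m : ℝ) ≤ 2 * h ^ γ) (x y : ℝ) :
    |profileScore K m h w x - profileScore K m h w y| ≤ |x - y| ^ γ := by
  have h1 := abs_stairSlope_sub_le w hm hh hhm hγ0 hγ1 hmγ (x - K) (y - K)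
  have h2 := abs_stairSlope_sub_le (fun j => !w j) hm hh hhm hγ0 hγ1 hmγ (-x - K) (-y - K)
  rw [show x - K - (y - K) = x - y by ring] at h1
  rw [show -x - K - (-y - K) = -(x - y) by ring, abs_neg] at h2
  rw [profileScore, profileScore]
  rw [abs_le] at h1 h2 ⊢
  constructor <;> linarith [h1.1, h1.2, h2.1, h2.2]

/-- The score vanishes on the plateau, and in the tail its square is at most `1 / 256` against a
mass of at most `32`. The bound is free of `K`, so normalising gains a factor `1 / K`. -/
theorem setLIntegral_profile_fisher_le (hK : 0 ≤ K) (hm : 0 < m) (hh : 0 < h) (hhm : h ≤ 1 / m) :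
    ∫⁻ x in Ioi 0, ENNReal.ofReal (profileScore K m h w x ^ 2 * profile K m h w x)
      ≤ ENNReal.ofReal (1 / 8) := by
  rw [← Ioc_union_Ioi_eq_Ioi hK, lintegral_union measurableSet_Ioi
    (by rw [disjoint_left]; intro x hx hx'; exact absurd hx.2 (not_le.2 hx'))]
  have h1 : ∫⁻ x in Ioc 0 K, ENNReal.ofReal (profileScore K m h w x ^ 2 * profile K m h w x) = 0 := by
    rw [setLIntegral_congr_fun (g := fun _ => 0) measurableSet_Ioc]
    · simp
    · intro x hx
      simp only
      rw [profileScore_of_nonneg w hK hh hx.1.le, stairSlope_of_nonpos w hh (by linarith [hx.2])]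
      simp
  rw [h1, zero_add]
  calc _ ≤ ∫⁻ x in Ioi K, ENNReal.ofReal (1 / 256)
          * ENNReal.ofReal (Real.exp ((1 - (x - K)) / 16)) := by
        refine setLIntegral_mono' measurableSet_Ioi fun x hx => ?_
        have hx0 : 0 ≤ x := hK.trans (mem_Ioi.1 hx).le
        rw [← ENNReal.ofReal_mul (by norm_num)]
        refine ENNReal.ofReal_le_ofReal ?_
        refine mul_le_mul ?_ (profile_le_tail w hK hm hh hhm hx0) (profile_pos _ _).le (by norm_num)
        rw [profileScore_of_nonneg w hK hh hx0, neg_sq]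
        have h2 := stairSlope_le w (h := h) hm (x - K)
        have h3 := stairSlope_nonneg w (h := h) (x - K)
        nlinarith
    _ ≤ ENNReal.ofReal (1 / 256) * ENNReal.ofReal 32 := by
        rw [lintegral_const_mul _ (by fun_prop)]
        gcongr
        exact setLIntegral_exp_tail_le K
    _ = _ := by rw [← ENNReal.ofReal_mul (by norm_num)]; norm_num

theorem lintegral_profile_fisher_le (hK : 0 ≤ K) (hm : 0 < m) (hh : 0 < h) (hhm : h ≤ 1 / m) :
    ∫⁻ x, ENNReal.ofReal (profileScore K m h w x ^ 2 * profile K m h w x)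
      ≤ ENNReal.ofReal (1 / 4) := by
  have hc : ∀ w : Fin m → Bool, Measurable
      fun x => ENNReal.ofReal (profileScore K m h w x ^ 2 * profile K m h w x) := fun w =>
    (((continuous_profileScore w).pow 2).mul (continuous_profile w hh)).measurable.ennreal_ofReal
  rw [lintegral_eq_lintegral_Ioi_add_neg (hc w), lintegral_add_left (hc w)]
  simp only [profileScore_neg, profile_neg, neg_sq]
  refine (add_le_add (setLIntegral_profile_fisher_le w hK hm hh hhm)
    (setLIntegral_profile_fisher_le _ hK hm hh hhm)).trans_eq ?_
  rw [← ENNReal.ofReal_add (by norm_num) (by norm_num)]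
  norm_num

/-- The square root halves the potential, and `exp (-x)` is 1-Lipschitz on `x ≥ 0`. Each differing
bit thus contributes a quarter of the squared discrepancy `h / (16 m)`, over a length `h`. -/
theorem setLIntegral_profile_hellinger_le (hK : 0 ≤ K) (hm : 0 < m) (hh : 0 < h) (hhm : h ≤ 1 / m)
    (w' : Fin m → Bool) :
    ∫⁻ x in Ioi 0, ENNReal.ofReal ((√(profile K m h w x) - √(profile K m h w' x)) ^ 2)
      ≤ ENNReal.ofReal (hammingDist w w' * ((1 / (16 * (m : ℝ)) * h) ^ 2 * h / 4)) := by
  have hpt : ∀ x ∈ Ioi (0 : ℝ), ENNReal.ofReal ((√(profile K m h w x) - √(profile K m h w' x)) ^ 2)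
      ≤ ∑ j with w j ≠ w' j, (Icc ((j : ℝ) / m) (j / m + h)).indicator
          (fun _ => ENNReal.ofReal ((1 / (16 * (m : ℝ)) * h) ^ 2 / 4)) (x - K) := by
    intro x hx
    have hx0 : 0 ≤ x := (mem_Ioi.1 hx).le
    rw [profile_of_nonneg w hK hh hx0, profile_of_nonneg w' hK hh hx0, ← Real.exp_half,
      ← Real.exp_half, neg_div, neg_div]
    refine (ENNReal.ofReal_le_ofReal (sq_exp_sub_exp_le (by linarith [stair_nonneg w hh (x - K)])
      (by linarith [stair_nonneg w' hh (x - K)]))).trans ?_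
    have e : (stair m h w (x - K) / 2 - stair m h w' (x - K) / 2) ^ 2
        = (stair m h w (x - K) - stair m h w' (x - K)) ^ 2 / 4 := by ring
    rw [e]
    refine (ENNReal.ofReal_le_ofReal (div_le_div_of_nonneg_right
      (stair_sub_sq_le w hm hh hhm w' (x - K)) (by norm_num))).trans ?_
    rw [Finset.sum_div, ENNReal.ofReal_sum_of_nonneg fun j _ => div_nonneg
      (indicator_nonneg (fun _ _ => by positivity) _) (by norm_num)]
    refine Finset.sum_le_sum fun j _ => ?_
    by_cases hj : x - K ∈ Icc ((j : ℝ) / m) (j / m + h)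
    · rw [indicator_of_mem hj, indicator_of_mem hj]
    · rw [indicator_of_notMem hj, indicator_of_notMem hj]; simp
  refine (setLIntegral_mono' measurableSet_Ioi hpt).trans ((setLIntegral_le_lintegral _ _).trans ?_)
  have hmeas : ∀ j : Fin m, Measurable ((Icc ((j : ℝ) / m) (j / m + h)).indicator
      (fun _ => ENNReal.ofReal ((1 / (16 * (m : ℝ)) * h) ^ 2 / 4))) := fun j =>
    measurable_const.indicator measurableSet_Icc
  have hmeas' : ∀ j : Fin m, Measurable fun x => (Icc ((j : ℝ) / m) (j / m + h)).indicator
      (fun _ => ENNReal.ofReal ((1 / (16 * (m : ℝ)) * h) ^ 2 / 4)) (x - K) := fun j =>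
    (hmeas j).comp (measurable_id.sub_const K)
  rw [lintegral_finsetSum _ fun j _ => hmeas' j]
  have hone : ∀ j : Fin m, ∫⁻ x, (Icc ((j : ℝ) / m) (j / m + h)).indicator
          (fun _ => ENNReal.ofReal ((1 / (16 * (m : ℝ)) * h) ^ 2 / 4)) (x - K)
      = ENNReal.ofReal ((1 / (16 * (m : ℝ)) * h) ^ 2 * h / 4) := by
    intro j
    rw [lintegral_sub_right_eq_self
      ((Icc ((j : ℝ) / m) (j / m + h)).indicator
        (fun _ => ENNReal.ofReal ((1 / (16 * (m : ℝ)) * h) ^ 2 / 4))) K,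
      lintegral_indicator_const measurableSet_Icc, Real.volume_Icc, add_sub_cancel_left,
      ← ENNReal.ofReal_mul (by positivity)]
    congr 1; ring
  simp_rw [hone]
  rw [Finset.sum_const, nsmul_eq_mul, ENNReal.ofReal_mul (by positivity), ENNReal.ofReal_natCast]
  rfl

theorem lintegral_profile_hellinger_le (hK : 0 ≤ K) (hm : 0 < m) (hh : 0 < h) (hhm : h ≤ 1 / m)
    (w' : Fin m → Bool) :
    ∫⁻ x, ENNReal.ofReal ((√(profile K m h w x) - √(profile K m h w' x)) ^ 2)
      ≤ ENNReal.ofReal (hammingDist w w' * ((1 / (16 * (m : ℝ)) * h) ^ 2 * h / 2)) := by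
  have hc : Measurable
      fun x => ENNReal.ofReal ((√(profile K m h w x) - √(profile K m h w' x)) ^ 2) := by
    have h1 := (continuous_profile (K := K) w hh).measurable
    have h2 := (continuous_profile (K := K) w' hh).measurable
    fun_prop
  rw [lintegral_eq_lintegral_Ioi_add_neg hc, lintegral_add_left hc]
  simp only [profile_neg]
  refine (add_le_add (setLIntegral_profile_hellinger_le w hK hm hh hhm w')
    (setLIntegral_profile_hellinger_le _ hK hm hh hhm _)).trans_eq ?_
  have : hammingDist (fun j => !w j) (fun j => !w' j) = hammingDist w w' := by
    unfold hammingDist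
    simp
  rw [this, ← ENNReal.ofReal_add (by positivity) (by positivity)]
  congr 1; ring

end Profile

/-! ### Normalised densities and the loss on blocks. -/

/-- The normalised density with profile `profile K m h w` at scale `1 / a`. -/
noncomputable def profileDensity (a K : ℝ) (m : ℕ) (h : ℝ) (w : Fin m → Bool) (x : ℝ) : ℝ :=
  a / profileMass K m h * profile K m h w (a * x)

/-- The parts of the line on which the scores for the two shapes of the `j`-th step are compared. -/
def stepBlock (a K : ℝ) (m : ℕ) (h : ℝ) (j : Fin m) : Set ℝ :=
  Icc ((K + j / m + h / 8) / a) ((K + j / m + h / 4) / a)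

/-- On the positive half-line, the score for steps that all have shape `k`. -/
noncomputable def constScore (a K : ℝ) (m : ℕ) (h : ℝ) (k : Bool) (x : ℝ) : ℝ :=
  -(a * stairSlope m h (fun _ => k) (a * x - K))

/-- The squared distance on the `j`-th block of `g` from the score for shape `k`. -/
noncomputable def blockLoss (a K : ℝ) (m : ℕ) (h : ℝ) (g : ℝ → ℝ) (k : Bool) (j : Fin m) : ℝ≥0∞ :=
  ∫⁻ x in stepBlock a K m h j, ENNReal.ofReal ((g x - constScore a K m h k x) ^ 2)

section Density

variable {a K : ℝ} {m : ℕ} {h : ℝ} (w : Fin m → Bool)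

theorem profileMass_pos (hK : 1 ≤ K) (hm : 0 < m) (hh : 0 < h) (hhm : h ≤ 1 / m) :
    0 < profileMass K m h := by
  have := (profileMass_bounds hK hm hh hhm).2.1
  linarith

theorem profileDensity_pos (ha : 0 < a) (hK : 1 ≤ K) (hm : 0 < m) (hh : 0 < h) (hhm : h ≤ 1 / m)
    (x : ℝ) : 0 < profileDensity a K m h w x :=
  mul_pos (div_pos ha (profileMass_pos hK hm hh hhm)) (profile_pos _ _)

theorem continuous_profileDensity (hh : 0 < h) : Continuous (profileDensity a K m h w) :=
  continuous_const.mul ((continuous_profile w hh).comp (continuous_const_mul a))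

theorem lintegral_scaled (ha : 0 < a) (hK : 1 ≤ K) (hm : 0 < m) (hh : 0 < h) (hhm : h ≤ 1 / m)
    {F : ℝ → ℝ} (hF : Measurable F) :
    ∫⁻ x, ENNReal.ofReal (a / profileMass K m h * F (a * x))
      = ENNReal.ofReal (1 / profileMass K m h) * ∫⁻ x, ENNReal.ofReal (F x) := by
  have hM := profileMass_pos hK hm hh hhm
  have h1 : ∀ x, ENNReal.ofReal (a / profileMass K m h * F (a * x))
      = ENNReal.ofReal (a / profileMass K m h) * ENNReal.ofReal (F (a * x)) := fun x =>
    ENNReal.ofReal_mul (by positivity)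
  have h2 : Measurable fun x => ENNReal.ofReal (F (a * x)) :=
    (hF.comp (measurable_const_mul a)).ennreal_ofReal
  simp_rw [h1]
  rw [lintegral_const_mul _ h2, lintegral_comp_mul_left_of_pos hF.ennreal_ofReal ha, ← mul_assoc,
    ← ENNReal.ofReal_mul (by positivity)]
  congr 2
  field_simp

theorem lintegral_profileDensity (ha : 0 < a) (hK : 1 ≤ K) (hm : 0 < m) (hh : 0 < h)
    (hhm : h ≤ 1 / m) : ∫⁻ x, ENNReal.ofReal (profileDensity a K m h w x) = 1 := by
  have hM := profileMass_pos hK hm hh hhm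
  unfold profileDensity
  rw [lintegral_scaled ha hK hm hh hhm (continuous_profile w hh).measurable,
    (profileMass_bounds hK hm hh hhm).1 w, ← ENNReal.ofReal_mul (by positivity),
    one_div_mul_cancel hM.ne', ENNReal.ofReal_one]

theorem hasDerivAt_log_profileDensity (ha : 0 < a) (hK : 1 ≤ K) (hm : 0 < m) (hh : 0 < h)
    (hhm : h ≤ 1 / m) (x : ℝ) :
    HasDerivAt (fun t => Real.log (profileDensity a K m h w t))
      (a * profileScore K m h w (a * x)) x := by
  have hM := profileMass_pos hK hm hh hhm
  have e : (fun t => Real.log (profileDensity a K m h w t))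
      = fun t => Real.log (a / profileMass K m h) + Real.log (profile K m h w (a * t)) :=
    funext fun t => Real.log_mul (by positivity) (profile_pos _ _).ne'
  rw [e]
  have h1 := (hasDerivAt_log_profile (K := K) w hh (a * x)).comp x ((hasDerivAt_id x).const_mul a)
  refine (h1.const_add (Real.log (a / profileMass K m h))).congr_deriv ?_
  ring

/-- Scaling multiplies both the score and its argument by `a`, so the Hölder constant `1` becomes `a
^ β`. The Fisher information is multiplied by `a ^ 2` and divided by the mass. -/
theorem profileDensity_mem (ha : 0 < a) (hK : 1 ≤ K) (hm : 0 < m) (hh : 0 < h) (hhm : h ≤ 1 / m)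
    {β L r : ℝ} (hβ1 : 1 ≤ β) (hβ2 : β ≤ 2) (hmγ : 1 / (m : ℝ) ≤ 2 * h ^ (β - 1))
    (hL : a ^ β = L) (hr : a ^ 2 / K ≤ r) :
    profileDensity a K m h w ∈ holderFisherClass β L r := by
  have hM := profileMass_pos hK hm hh hhm
  refine mem_holderFisherClass (profileDensity_pos w ha hK hm hh hhm) (continuous_profileDensity w hh)
    (lintegral_profileDensity w ha hK hm hh hhm) (hasDerivAt_log_profileDensity w ha hK hm hh hhm)
    (fun x y hxy => mul_le_mul_of_nonneg_left (profileScore_antitone w hh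
      (mul_le_mul_of_nonneg_left hxy ha.le)) ha.le) (fun x y => ?_) ?_
  · have h1 := abs_profileScore_sub_le (K := K) w hm hh hhm (sub_nonneg.2 hβ1)
      (by linarith : β - 1 ≤ 1) hmγ (a * x) (a * y)
    rw [← mul_sub, abs_mul, abs_of_pos ha]
    rw [← mul_sub, abs_mul, abs_of_pos ha, Real.mul_rpow ha.le (abs_nonneg _)] at h1
    refine (mul_le_mul_of_nonneg_left h1 ha.le).trans_eq ?_
    rw [← hL, ← mul_assoc, ← Real.rpow_one_add' ha.le (by linarith)]
    congr 2
    ring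
  · have e : ∀ x, (a * profileScore K m h w (a * x)) ^ 2 * profileDensity a K m h w x
        = a / profileMass K m h * (fun y => a ^ 2 * (profileScore K m h w y ^ 2
          * profile K m h w y)) (a * x) := fun x => by
      simp only [profileDensity]; ring
    have hmeas : Measurable fun y => profileScore K m h w y ^ 2 * profile K m h w y :=
      (((continuous_profileScore w).pow 2).mul (continuous_profile w hh)).measurable
    simp_rw [e]
    rw [lintegral_scaled ha hK hm hh hhm (hmeas.const_mul _)]
    simp_rw [ENNReal.ofReal_mul (sq_nonneg a)]
    rw [lintegral_const_mul _ hmeas.ennreal_ofReal]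
    refine (mul_le_mul_right (mul_le_mul_right (lintegral_profile_fisher_le w (by linarith) hm hh hhm)
      _) _).trans ?_
    rw [← ENNReal.ofReal_mul (by positivity), ← ENNReal.ofReal_mul (by positivity)]
    refine ENNReal.ofReal_le_ofReal (le_trans ?_ hr)
    rw [one_div_mul_eq_div]
    have h2 := (profileMass_bounds hK hm hh hhm).2.1
    have : a ^ 2 * (1 / 4) ≤ a ^ 2 := by nlinarith [sq_nonneg a]
    gcongr
    linarith

theorem lintegral_profileDensity_hellinger_le (ha : 0 < a) (hK : 1 ≤ K) (hm : 0 < m) (hh : 0 < h)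
    (hhm : h ≤ 1 / m) (w' : Fin m → Bool) :
    ∫⁻ x, ENNReal.ofReal ((√(profileDensity a K m h w x) - √(profileDensity a K m h w' x)) ^ 2)
      ≤ ENNReal.ofReal (hammingDist w w' * (h ^ 3 / (1024 * m ^ 2 * K))) := by
  have hM := profileMass_pos hK hm hh hhm
  have e : ∀ x, (√(profileDensity a K m h w x) - √(profileDensity a K m h w' x)) ^ 2
      = a / profileMass K m h
        * (fun y => (√(profile K m h w y) - √(profile K m h w' y)) ^ 2) (a * x) := fun x => by
    have h0 : 0 ≤ a / profileMass K m h := by positivity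
    simp only [profileDensity]
    rw [Real.sqrt_mul h0, Real.sqrt_mul h0, ← mul_sub, mul_pow, Real.sq_sqrt h0]
  have hmeas : Measurable fun y => (√(profile K m h w y) - √(profile K m h w' y)) ^ 2 := by
    have h1 := (continuous_profile (K := K) w hh).measurable
    have h2 := (continuous_profile (K := K) w' hh).measurable
    fun_prop
  simp_rw [e]
  rw [lintegral_scaled ha hK hm hh hhm hmeas]
  refine (mul_le_mul_right (lintegral_profile_hellinger_le w (by linarith) hm hh hhm w') _).trans ?_
  rw [← ENNReal.ofReal_mul (by positivity)]
  refine ENNReal.ofReal_le_ofReal ?_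
  have h2 := (profileMass_bounds hK hm hh hhm).2.1
  calc 1 / profileMass K m h * (hammingDist w w' * ((1 / (16 * m) * h) ^ 2 * h / 2))
      ≤ 1 / (2 * K) * (hammingDist w w' * ((1 / (16 * m) * h) ^ 2 * h / 2)) := by gcongr
    _ = _ := by ring

theorem measurable_constScore (k : Bool) : Measurable (constScore a K m h k) := by
  have := continuous_stairSlope (h := h) (fun _ : Fin m => k)
  unfold constScore
  exact Continuous.measurable (by fun_prop)

theorem mem_stepBlock (ha : 0 < a) {j : Fin m} {x : ℝ} (hx : x ∈ stepBlock a K m h j) :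
    j / m + h / 8 ≤ a * x - K ∧ a * x - K ≤ j / m + h / 4 := by
  have h1 := (div_le_iff₀ ha).1 hx.1
  have h2 := (le_div_iff₀ ha).1 hx.2
  constructor <;> linarith

theorem measurableSet_stepBlock (j : Fin m) : MeasurableSet (stepBlock a K m h j) :=
  measurableSet_Icc

theorem volume_stepBlock (ha : 0 < a) (j : Fin m) :
    volume (stepBlock a K m h j) = ENNReal.ofReal (h / (8 * a)) := by
  rw [stepBlock, Real.volume_Icc]
  congr 1
  field_simp
  ring

theorem pairwise_disjoint_stepBlock (ha : 0 < a) (hh : 0 < h) (hhm : h ≤ 1 / m) :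
    Pairwise (Function.onFun Disjoint (stepBlock a K m h)) := by
  have key : ∀ i j : Fin m, i < j → Disjoint (stepBlock a K m h i) (stepBlock a K m h j) := by
    intro i j hij
    have hm : (0 : ℝ) < m := by exact_mod_cast i.pos
    rw [disjoint_left]
    intro x hi hj
    have h1 := (mem_stepBlock ha hi).2
    have h2 := (mem_stepBlock ha hj).1
    have : (((i : ℕ) : ℝ) + 1) / m ≤ j / m := by
      gcongr
      exact_mod_cast hij
    rw [add_div] at this
    linarith
  intro i j hij
  rcases lt_or_gt_of_ne hij with h1 | h1
  · exact key i j h1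
  · exact (key j i h1).symm

/-- On the blocks the potential is at most `1 / 16`, so the profile is at least `1 / 2` and the
density at least `a / (132 K)`. -/
theorem sum_blockLoss_le_loss (ha : 0 < a) (hK : 1 ≤ K) (hm : 0 < m) (hh : 0 < h) (hhm : h ≤ 1 / m)
    (g : ℝ → ℝ) :
    ENNReal.ofReal (a / (132 * K)) * ∑ j, blockLoss a K m h g (w j) j
      ≤ loss (profileDensity a K m h w) g (score (profileDensity a K m h w)) := by
  have hM := profileMass_pos hK hm hh hhm
  rw [loss_score_eq (profileDensity_pos w ha hK hm hh hhm)
    (hasDerivAt_log_profileDensity w ha hK hm hh hhm)]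
  refine le_trans ?_ (setLIntegral_le_lintegral (⋃ j, stepBlock a K m h j) _)
  rw [lintegral_iUnion measurableSet_stepBlock (pairwise_disjoint_stepBlock ha hh hhm),
    tsum_fintype, Finset.mul_sum]
  refine Finset.sum_le_sum fun j _ => ?_
  rw [blockLoss, ← lintegral_const_mul' _ _ ENNReal.ofReal_ne_top]
  refine setLIntegral_mono' measurableSet_Icc fun x hx => ?_
  obtain ⟨h1, h2⟩ := mem_stepBlock ha hx
  have hj0 : (0 : ℝ) ≤ (j : ℝ) / m := by positivity
  have h0 : 0 ≤ a * x := by linarith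
  have hj1 := step_end_le_one hhm j
  have e : a * profileScore K m h w (a * x) = constScore a K m h (w j) x := by
    rw [profileScore_of_nonneg w (by linarith) hh h0, constScore,
      stairSlope_eq_const w hh hhm j (by linarith) (by rw [add_div]; linarith)]
    ring
  rw [e, mul_comm]
  gcongr
  rw [profileDensity, profile_of_nonneg w (by linarith) hh h0]
  have h3 := stair_le w hm hh (t := a * x - K) (by linarith)
  have h4 : 1 / 2 ≤ Real.exp (-stair m h w (a * x - K)) := by
    linarith [Real.add_one_le_exp (-stair m h w (a * x - K))]
  have h5 := (profileMass_bounds hK hm hh hhm).2.2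
  calc a / (132 * K) = a / (66 * K) * (1 / 2) := by ring
    _ ≤ _ := by gcongr

/-- No function is close to both scores: they differ by at least `a / (128 m)` on a block of length
`h / (8 a)`, and `(u - v)² ≤ 2 (u² + v²)`. -/
theorem le_blockLoss_add (ha : 0 < a) (hh : 0 < h) (hhm : h ≤ 1 / m) {g : ℝ → ℝ}
    (hg : Measurable g) (j : Fin m) :
    ENNReal.ofReal (a * h / (2 ^ 18 * m ^ 2))
      ≤ blockLoss a K m h g true j + blockLoss a K m h g false j := by
  have hm : (0 : ℝ) < m := by exact_mod_cast j.pos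
  have hmeas : ∀ k, Measurable fun x => ENNReal.ofReal ((g x - constScore a K m h k x) ^ 2) :=
    fun k => ((hg.sub (measurable_constScore k)).pow_const 2).ennreal_ofReal
  rw [blockLoss, blockLoss, ← lintegral_add_left (hmeas true)]
  calc ENNReal.ofReal (a * h / (2 ^ 18 * m ^ 2))
      = ∫⁻ x in stepBlock a K m h j, ENNReal.ofReal ((a * (1 / (128 * m))) ^ 2 / 2) := by
        rw [setLIntegral_const, volume_stepBlock ha, ← ENNReal.ofReal_mul (by positivity)]
        congr 1
        field_simp
        norm_num
    _ ≤ _ := by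
        refine setLIntegral_mono' measurableSet_Icc fun x hx => ?_
        obtain ⟨h1, h2⟩ := mem_stepBlock ha hx
        rw [← ENNReal.ofReal_add (sq_nonneg _) (sq_nonneg _)]
        refine ENNReal.ofReal_le_ofReal ?_
        have h3 := stairSlope_sep hh hhm j h1 h2
        have h4 : (1 / (128 * (m : ℝ))) ^ 2 ≤ (stairSlope m h (fun _ => true) (a * x - K)
            - stairSlope m h (fun _ => false) (a * x - K)) ^ 2 := by
          rw [← sq_abs (_ - _)]
          gcongr
        have h5 : (a * (1 / (128 * m))) ^ 2
            ≤ (constScore a K m h true x - constScore a K m h false x) ^ 2 := by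
          rw [constScore, constScore, mul_pow]
          refine (mul_le_mul_of_nonneg_left h4 (sq_nonneg a)).trans_eq ?_
          ring
        nlinarith [sq_nonneg ((g x - constScore a K m h true x)
          + (g x - constScore a K m h false x))]

/-! ### From an estimator to tests of the bits. -/

/-- The sample points at which the estimator `g` is closer on the `j`-th block to the score for the
shape `true` than to the one for the shape `false`. -/
def shapeTest (a K : ℝ) (m : ℕ) (h : ℝ) {n : ℕ} (g : Estimator n) (j : Fin m) : Set (Fin n → ℝ) :=
  {X | blockLoss a K m h (fun x => g.1 x X) true j < blockLoss a K m h (fun x => g.1 x X) false j}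

/-- The event that the shape of the `j`-th step is not correctly recovered. -/
def shapeError (a K : ℝ) (m : ℕ) (h : ℝ) {n : ℕ} (g : Estimator n) (j : Fin m) (k : Bool) :
    Set (Fin n → ℝ) :=
  if k then (shapeTest a K m h g j)ᶜ else shapeTest a K m h g j

theorem measurable_blockLoss {n : ℕ} (g : Estimator n) (k : Bool) (j : Fin m) :
    Measurable fun X => blockLoss a K m h (fun x => g.1 x X) k j := by
  have h1 : Measurable fun p : (Fin n → ℝ) × ℝ =>
      ENNReal.ofReal ((g.1 p.2 p.1 - constScore a K m h k p.2) ^ 2) := by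
    have h2 : Measurable fun p : (Fin n → ℝ) × ℝ => g.1 p.2 p.1 := g.2.comp measurable_swap
    exact ((h2.sub ((measurable_constScore k).comp measurable_snd)).pow_const 2).ennreal_ofReal
  exact h1.lintegral_prod_right'

theorem measurableSet_shapeTest {n : ℕ} (g : Estimator n) (j : Fin m) :
    MeasurableSet (shapeTest a K m h g j) :=
  measurableSet_lt (measurable_blockLoss g true j) (measurable_blockLoss g false j)

theorem measurableSet_shapeError {n : ℕ} (g : Estimator n) (j : Fin m) (k : Bool) :
    MeasurableSet (shapeError a K m h g j k) := by
  cases k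
  · exact measurableSet_shapeTest g j
  · exact (measurableSet_shapeTest g j).compl

/-- When the wrong shape is at least as close, the loss for the right one is at least half of the
sum of the two. -/
theorem le_blockLoss_of_mem_shapeError (ha : 0 < a) (hh : 0 < h) (hhm : h ≤ 1 / m) {n : ℕ}
    {g : Estimator n} {j : Fin m} {k : Bool} {X : Fin n → ℝ} (hX : X ∈ shapeError a K m h g j k) :
    ENNReal.ofReal (a * h / (2 ^ 19 * m ^ 2)) ≤ blockLoss a K m h (fun x => g.1 x X) k j := by
  have hg : Measurable fun x => g.1 x X := g.2.comp measurable_prodMk_right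
  have h1 := le_blockLoss_add (K := K) ha hh hhm hg j
  have h2 : blockLoss a K m h (fun x => g.1 x X) true j
      + blockLoss a K m h (fun x => g.1 x X) false j
      ≤ 2 * blockLoss a K m h (fun x => g.1 x X) k j := by
    rw [two_mul]
    cases k
    · exact add_le_add (le_of_lt hX) le_rfl
    · exact add_le_add le_rfl (not_lt.1 hX)
  have h3 := h1.trans h2
  have e : ENNReal.ofReal (a * h / (2 ^ 18 * m ^ 2))
      = 2 * ENNReal.ofReal (a * h / (2 ^ 19 * m ^ 2)) := by
    rw [show (2 : ℝ≥0∞) = ENNReal.ofReal 2 by norm_num, ← ENNReal.ofReal_mul (by norm_num)]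
    congr 1
    ring
  rw [e] at h3
  exact (ENNReal.mul_le_mul_iff_right (by norm_num) (by norm_num)).1 h3

open Classical in
/-- The number of steps with an incorrectly recovered shape. -/
noncomputable def shapeErrors (a K : ℝ) (m : ℕ) (h : ℝ) {n : ℕ} (g : Estimator n) (w : Fin m → Bool)
    (X : Fin n → ℝ) : ℕ :=
  Finset.card {j | X ∈ shapeError a K m h g j (w j)}

theorem shapeErrors_mul_le_estLoss (ha : 0 < a) (hK : 1 ≤ K) (hm : 0 < m) (hh : 0 < h)
    (hhm : h ≤ 1 / m) {n : ℕ} (g : Estimator n) (X : Fin n → ℝ) :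
    ENNReal.ofReal (shapeErrors a K m h g w X * (a ^ 2 * h / (2 ^ 27 * K * m ^ 2)))
      ≤ estLoss g (profileDensity a K m h w) X := by
  classical
  refine le_trans ?_ (sum_blockLoss_le_loss w ha hK hm hh hhm fun x => g.1 x X)
  have h1 : ∑ j with X ∈ shapeError a K m h g j (w j), ENNReal.ofReal (a * h / (2 ^ 19 * m ^ 2))
      ≤ ∑ j, blockLoss a K m h (fun x => g.1 x X) (w j) j :=
    (Finset.sum_le_sum fun j hj =>
      le_blockLoss_of_mem_shapeError ha hh hhm (Finset.mem_filter.1 hj).2).trans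
      (Finset.sum_le_univ_sum_of_nonneg fun _ => bot_le)
  refine le_trans ?_ (mul_le_mul_right h1 _)
  rw [Finset.sum_const, nsmul_eq_mul, ← ENNReal.ofReal_natCast, ← ENNReal.ofReal_mul (by positivity),
    ← ENNReal.ofReal_mul (by positivity)]
  refine ENNReal.ofReal_le_ofReal ?_
  have e : (Finset.card {j | X ∈ shapeError a K m h g j (w j)} : ℝ)
      = shapeErrors a K m h g w X := by
    rw [shapeErrors]
  rw [e]
  have hm' : (0 : ℝ) < m := by positivity
  have hN : (0 : ℝ) ≤ shapeErrors a K m h g w X := Nat.cast_nonneg _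
  generalize (shapeErrors a K m h g w X : ℝ) = N at *
  calc N * (a ^ 2 * h / (2 ^ 27 * K * m ^ 2)) = N * (a ^ 2 * h / (K * m ^ 2)) * (1 / 2 ^ 27) := by
        ring
    -- The density bound contributes `132`, rounded up to `2 ^ 8`, and the block bound `2 ^ 19`.
    _ ≤ N * (a ^ 2 * h / (K * m ^ 2)) * (1 / (132 * 2 ^ 19)) := by
        gcongr
        norm_num
    _ = _ := by field_simp

end Density

/-! ### Assouad's lemma and elementary probability bounds. -/

section Testing

variable {m : ℕ}

theorem card_events_eq_sum {Ω : Type*} {E : Fin m → Set Ω} (X : Ω)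
    [DecidablePred fun j => X ∈ E j] :
    (Finset.card {j | X ∈ E j} : ℝ) = ∑ j, (E j).indicator 1 X := by
  rw [Finset.card_filter]
  push_cast
  refine Finset.sum_congr rfl fun j _ => ?_
  by_cases hj : X ∈ E j <;> simp [hj]

variable {Ω : Type*} [MeasurableSpace Ω]

/-- Assouad's lemma: some vertex of the cube has a large expected number of errors. -/
theorem exists_le_sum_error (ν : (Fin m → Bool) → Measure Ω) (E : Fin m → Bool → Set Ω) {α : ℝ}
    (hE : ∀ w j, α ≤ (ν w).real (E j (w j))
      + (ν (Function.update w j (!w j))).real (E j (!w j))) :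
    ∃ w, m * (α / 2) ≤ ∑ j, (ν w).real (E j (w j)) := by
  have hj : ∀ j : Fin m, ∑ _w : Fin m → Bool, α / 2 ≤ ∑ w, (ν w).real (E j (w j)) := by
    intro j
    -- Flipping bit `j` permutes the cube, so after summing over all vertices the two terms of `hE`
    -- have equal totals.
    have hinv : Function.Involutive fun w : Fin m → Bool => Function.update w j (!w j) := by
      intro w
      simp
    have h1 := Equiv.sum_comp hinv.toPerm fun w => (ν w).real (E j (w j))
    simp only [Function.Involutive.coe_toPerm, Function.update_self] at h1
    have h2 : ∑ _w : Fin m → Bool, α ≤ ∑ w, ((ν w).real (E j (w j))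
      + (ν (Function.update w j (!w j))).real (E j (!w j))) := Finset.sum_le_sum fun w _ => hE w j
    rw [Finset.sum_add_distrib, h1] at h2
    rw [← Finset.sum_div]
    linarith
  have h3 : ∑ _w : Fin m → Bool, (m : ℝ) * (α / 2) ≤ ∑ w, ∑ j, (ν w).real (E j (w j)) := by
    rw [Finset.sum_comm]
    refine le_trans (le_of_eq ?_) (Finset.sum_le_sum fun j _ => hj j)
    simp only [Finset.sum_const, Finset.card_univ, Fintype.card_fin, nsmul_eq_mul]
    ring
  obtain ⟨w, _, hw⟩ := Finset.exists_le_of_sum_le Finset.univ_nonempty h3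
  exact ⟨w, hw⟩

/-- Reverse Markov inequality: a count bounded by `m` with mean at least `3 m / 8` reaches `m / 16`
with probability at least `3/8 - 1/16 = 5/16`. -/
theorem prob_many_events_ge (hm : 0 < m) (μ : Measure Ω) [IsProbabilityMeasure μ]
    {E : Fin m → Set Ω} (hE : ∀ j, MeasurableSet (E j)) {N : Ω → ℝ}
    (hN : ∀ X, N X = ∑ j, (E j).indicator 1 X) (hsum : m * (3 / 8 : ℝ) ≤ ∑ j, μ.real (E j))
    (hS : MeasurableSet {X | (m : ℝ) / 16 ≤ N X}) :
    5 / 16 ≤ μ.real {X | (m : ℝ) / 16 ≤ N X} := by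
  have hm' : (0 : ℝ) < m := by positivity
  have hi : ∀ j, Integrable ((E j).indicator (1 : Ω → ℝ)) μ := fun j =>
    (integrable_const (1 : ℝ)).indicator (hE j)
  have hint : ∫ X, N X ∂μ = ∑ j, μ.real (E j) := by
    simp_rw [hN]
    rw [integral_finsetSum _ fun j _ => hi j]
    exact Finset.sum_congr rfl fun j _ => integral_indicator_one (hE j)
  have hle : ∀ X, N X ≤ m / 16 + m * {X | (m : ℝ) / 16 ≤ N X}.indicator 1 X := by
    intro X
    by_cases hX : X ∈ {X | (m : ℝ) / 16 ≤ N X}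
    · rw [indicator_of_mem hX, hN]
      have : ∑ j, (E j).indicator (1 : Ω → ℝ) X ≤ ∑ _j : Fin m, 1 :=
        Finset.sum_le_sum fun j _ => indicator_apply_le' (fun _ => le_rfl) fun _ => zero_le_one
      simp only [Finset.sum_const, Finset.card_univ, Fintype.card_fin, nsmul_eq_mul,
        mul_one, Pi.one_apply] at this ⊢
      linarith
    · rw [indicator_of_notMem hX, mul_zero, add_zero]
      exact (not_le.1 hX).le
  have hiS : Integrable (fun X => m * {X | (m : ℝ) / 16 ≤ N X}.indicator (1 : Ω → ℝ) X) μ :=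
    ((integrable_const (1 : ℝ)).indicator hS).const_mul _
  have hmono : ∫ X, N X ∂μ
      ≤ ∫ X, (m / 16 + m * {X | (m : ℝ) / 16 ≤ N X}.indicator (1 : Ω → ℝ) X) ∂μ := by
    refine integral_mono ?_ ((integrable_const _).add hiS) hle
    rw [show N = fun X => ∑ j, (E j).indicator (1 : Ω → ℝ) X from funext hN]
    exact integrable_finsetSum _ fun j _ => hi j
  rw [integral_add (integrable_const _) hiS, integral_const_mul, integral_indicator_one hS,
    integral_const, probReal_univ, one_smul, hint] at hmono
  have h1 : (m : ℝ) * (3 / 8) ≤ m * (1 / 16 + μ.real {X | (m : ℝ) / 16 ≤ N X}) := by linarith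
  have h2 := le_of_mul_le_mul_left h1 hm'
  linarith

/-- Bernoulli's inequality turns an exponential lower bound into a bound on error probabilities. -/
theorem two_mul_lt_of_exp_le {δ s : ℝ} (hδ0 : 0 < δ) (hδ : δ ≤ 1 / 4)
    (hs : Real.exp (-(Real.log (1 / δ) / 256)) ≤ s * (2 - s)) : 2 * δ < s := by
  by_contra hcon
  push Not at hcon
  -- `s (2 - s)` increases up to `s = 1`, and here `s ≤ 2 δ ≤ 1 / 2`.
  have h1 : s * (2 - s) ≤ 4 * δ * (1 - δ) := by nlinarith
  have h2 : (1 / δ) ^ (1 / 256 : ℝ) ≤ 1 + 1 / 256 * (1 / δ - 1) := by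
    have hb : -1 ≤ 1 / δ - 1 := by
      have : 0 < 1 / δ := by positivity
      linarith
    have := rpow_one_add_le_one_add_mul_self hb (p := 1 / 256) (by norm_num) (by norm_num)
    simpa using this
  have h3 : Real.exp (-(Real.log (1 / δ) / 256)) * (1 / δ) ^ (1 / 256 : ℝ) = 1 := by
    rw [Real.rpow_def_of_pos (by positivity), ← Real.exp_add]
    rw [show -(Real.log (1 / δ) / 256) + Real.log (1 / δ) * (1 / 256) = 0 by ring, Real.exp_zero]
  have h4 : 1 ≤ 4 * δ * (1 - δ) * (1 + 1 / 256 * (1 / δ - 1)) := by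
    calc (1 : ℝ) = Real.exp (-(Real.log (1 / δ) / 256)) * (1 / δ) ^ (1 / 256 : ℝ) := h3.symm
      _ ≤ _ := by
        have := Real.exp_pos (-(Real.log (1 / δ) / 256))
        have h5 : 0 ≤ (1 / δ) ^ (1 / 256 : ℝ) := by positivity
        refine mul_le_mul (hs.trans h1) h2 h5 ?_
        nlinarith
  have h6 : 4 * δ * (1 - δ) * (1 + 1 / 256 * (1 / δ - 1))
      = 4 * (1 - δ) * (δ + 1 / 256 * (1 - δ)) := by
    field_simp
  rw [h6] at h4
  nlinarith

/-- On `[0, 1]`, `(1 + η) (1 - η / 2) ≥ 1` and `1 + η ≤ exp η`, whence `exp (-η) ≤ 1 - η / 2`. -/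
theorem exp_le_one_sub_pow {η c : ℝ} (hη0 : 0 ≤ η) (hη1 : η ≤ 1) {n : ℕ} (hc : 2 * (n * η) ≤ c) :
    Real.exp (-c) ≤ (1 - η / 2) ^ (2 * n) := by
  have h1 : Real.exp (-η) ≤ 1 - η / 2 := by
    have h2 := Real.add_one_le_exp η
    rw [Real.exp_neg, inv_le_comm₀ (Real.exp_pos _) (by linarith)]
    refine le_trans ?_ h2
    rw [inv_le_iff_one_le_mul₀ (by linarith)]
    nlinarith
  calc Real.exp (-c) ≤ Real.exp ((2 * n : ℕ) * -η) := by
        rw [Real.exp_le_exp]; push_cast; linarith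
    _ = Real.exp (-η) ^ (2 * n) := Real.exp_nat_mul _ _
    _ ≤ _ := pow_le_pow_left₀ (Real.exp_pos _).le h1 _

end Testing

/-! ### From testing errors to quantiles and risks. -/

section Reduction

variable {n : ℕ}

/-- A level `t` below `T` would confine `{loss ≤ t}` to the complement of `S`, of probability less
than `1 - δ`. Only `S` needs to be measurable. -/
theorem le_lossQuantile {δ T : ℝ} {g : Estimator n} {f : ℝ → ℝ}
    (hf1 : ∫⁻ x, ENNReal.ofReal (f x) = 1) {S : Set (Fin n → ℝ)} (hS : MeasurableSet S)
    (hδ : δ < (sampleLaw n f).real S) (hT : ∀ X ∈ S, ENNReal.ofReal T ≤ estLoss g f X) :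
    ENNReal.ofReal T ≤ lossQuantile δ g f := by
  have := isProbabilityMeasure_sampleLaw hf1 n
  refine le_iInf₂ fun t ht => ?_
  by_contra hlt
  push Not at hlt
  have hsub : {X | estLoss g f X ≤ t} ⊆ Sᶜ := fun X hX hXS =>
    absurd ((hT X hXS).trans hX) (not_le.2 hlt)
  have h1 := ht.trans (measure_mono hsub)
  rw [ENNReal.ofReal_le_iff_le_toReal (measure_ne_top _ _)] at h1
  have h2 := probReal_compl_eq_one_sub (μ := sampleLaw n f) hS
  rw [measureReal_def] at h2
  linarith

theorem le_lintegral_estLoss {p T : ℝ} {g : Estimator n} {f : ℝ → ℝ}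
    (hf1 : ∫⁻ x, ENNReal.ofReal (f x) = 1) {S : Set (Fin n → ℝ)} (hS : MeasurableSet S)
    (hp0 : 0 ≤ p) (hp : p ≤ (sampleLaw n f).real S)
    (hT : ∀ X ∈ S, ENNReal.ofReal T ≤ estLoss g f X) :
    ENNReal.ofReal (p * T) ≤ ∫⁻ X, estLoss g f X ∂(sampleLaw n f) := by
  have := isProbabilityMeasure_sampleLaw hf1 n
  calc ENNReal.ofReal (p * T) = ENNReal.ofReal p * ENNReal.ofReal T := ENNReal.ofReal_mul hp0
    _ ≤ sampleLaw n f S * ENNReal.ofReal T := by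
        gcongr
        exact (ENNReal.ofReal_le_iff_le_toReal (measure_ne_top _ _)).2 hp
    _ = ∫⁻ _ in S, ENNReal.ofReal T ∂(sampleLaw n f) := by rw [setLIntegral_const, mul_comm]
    _ ≤ ∫⁻ X in S, estLoss g f X ∂(sampleLaw n f) := setLIntegral_mono' hS hT
    _ ≤ _ := setLIntegral_le_lintegral _ _

variable {a K : ℝ} {m : ℕ} {h : ℝ}

theorem shapeErrors_eq_sum (g : Estimator n) (w : Fin m → Bool) (X : Fin n → ℝ) :
    (shapeErrors a K m h g w X : ℝ) = ∑ j, (shapeError a K m h g j (w j)).indicator 1 X := by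
  classical
  rw [← card_events_eq_sum X, shapeErrors]

theorem measurableSet_le_shapeErrors (g : Estimator n) (w : Fin m → Bool) (c : ℝ) :
    MeasurableSet {X | c ≤ (shapeErrors a K m h g w X : ℝ)} := by
  simp_rw [shapeErrors_eq_sum]
  refine measurableSet_le measurable_const (Finset.measurable_sum _ fun j _ => ?_)
  exact measurable_one.indicator (measurableSet_shapeError g j (w j))

/-- Each test accepts exactly one shape, so a bit is wrong for exactly one of the two opposite
vertices. -/
theorem shapeErrors_add_compl (g : Estimator n) (X : Fin n → ℝ) :
    (shapeErrors a K m h g (fun _ => false) X : ℝ) + shapeErrors a K m h g (fun _ => true) X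
      = m := by
  rw [shapeErrors_eq_sum, shapeErrors_eq_sum, ← Finset.sum_add_distrib]
  have : ∀ j : Fin m, (shapeError a K m h g j false).indicator (1 : (Fin n → ℝ) → ℝ) X
      + (shapeError a K m h g j true).indicator 1 X = 1 := by
    intro j
    by_cases hX : X ∈ shapeTest a K m h g j <;> simp [shapeError, hX]
  simp [this]

theorem testing_profileDensity (ha : 0 < a) (hK : 1 ≤ K) (hm : 0 < m) (hh : 0 < h) (hhm : h ≤ 1 / m)
    (w w' : Fin m → Bool) {η : ℝ} (hη : η = hammingDist w w' * (h ^ 3 / (1024 * m ^ 2 * K)))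
    {A : Set (Fin n → ℝ)} (hA : MeasurableSet A) {s : ℝ}
    (hs : s = (sampleLaw n (profileDensity a K m h w)).real A
      + (sampleLaw n (profileDensity a K m h w')).real Aᶜ) :
    0 ≤ η ∧ η ≤ 1 ∧ (1 - η / 2) ^ (2 * n) ≤ s * (2 - s) := by
  have hm1 : (1 : ℝ) ≤ m := by exact_mod_cast hm
  have h0 : 0 ≤ η := by rw [hη]; positivity
  have h1 : η ≤ 1 := by
    have hd : (hammingDist w w' : ℝ) ≤ m := by
      have := hammingDist_le_card_fintype (x := w) (y := w')
      rw [Fintype.card_fin] at this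
      exact_mod_cast this
    have hh1 : h ≤ 1 := hhm.trans ((div_le_one (by positivity)).2 hm1)
    rw [hη, ← mul_div_assoc, div_le_one (by positivity)]
    have hh3 : h ^ 3 ≤ 1 := pow_le_one₀ hh.le hh1
    calc (hammingDist w w' : ℝ) * h ^ 3 ≤ m * 1 := by gcongr
      _ ≤ 1024 * m ^ 2 * 1 := by nlinarith
      _ ≤ _ := by gcongr
  refine ⟨h0, h1, testing_le_of_hellinger (continuous_profileDensity w hh).measurable
    (continuous_profileDensity w' hh).measurable
    (fun x => (profileDensity_pos w ha hK hm hh hhm x).le)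
    (fun x => (profileDensity_pos w' ha hK hm hh hhm x).le)
    (lintegral_profileDensity w ha hK hm hh hhm) (lintegral_profileDensity w' ha hK hm hh hhm)
    h0 (by linarith) ?_ n hA hs⟩
  rw [hη]
  exact lintegral_profileDensity_hellinger_le w ha hK hm hh hhm w'

theorem shapeError_not (g : Estimator n) (j : Fin m) (k : Bool) :
    shapeError a K m h g j (!k) = (shapeError a K m h g j k)ᶜ := by
  cases k <;> simp [shapeError]

/-- For neighbouring vertices `n` times the squared Hellinger distance is at most `1 / 256`, so the
two error probabilities for the flipped bit add up to at least `3 / 4`. -/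
theorem exists_many_errors (ha : 0 < a) (hK : 1 ≤ K) (hm : 0 < m) (hh : 0 < h) (hhm : h ≤ 1 / m)
    (hn : n * (h ^ 3 / (m ^ 2 * K)) ≤ 4) (g : Estimator n) :
    ∃ w : Fin m → Bool, 5 / 16 ≤ (sampleLaw n (profileDensity a K m h w)).real
      {X | (m : ℝ) / 16 ≤ shapeErrors a K m h g w X} := by
  obtain ⟨w, hw⟩ := exists_le_sum_error (m := m) (α := 3 / 4)
    (fun w => sampleLaw n (profileDensity a K m h w)) (fun j k => shapeError a K m h g j k) (by
      intro w j
      rw [shapeError_not]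
      obtain ⟨h0, h1, h2⟩ := testing_profileDensity (n := n) ha hK hm hh hhm w
        (Function.update w j (!w j)) rfl (measurableSet_shapeError g j (w j)) rfl
      have hd : hammingDist w (Function.update w j (!w j)) = 1 := by
        unfold hammingDist
        rw [Finset.card_eq_one]
        refine ⟨j, Finset.ext fun i => ?_⟩
        by_cases hij : i = j
        · subst hij; simp
        · simp [hij]
      rw [hd, Nat.cast_one, one_mul] at h0 h1 h2
      have h3 := one_add_mul_le_pow (a := -(h ^ 3 / (1024 * m ^ 2 * K) / 2)) (by linarith) (2 * n)
      rw [← sub_eq_add_neg] at h3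
      have h4 : n * (h ^ 3 / (1024 * m ^ 2 * K)) ≤ 1 / 256 := by
        calc n * (h ^ 3 / (1024 * m ^ 2 * K)) = n * (h ^ 3 / (m ^ 2 * K)) / 1024 := by ring
          _ ≤ 1 / 256 := by linarith
      push_cast at h3
      by_contra hcon
      push Not at hcon
      nlinarith)
  have := isProbabilityMeasure_sampleLaw (lintegral_profileDensity w ha hK hm hh hhm) n
  exact ⟨w, prob_many_events_ge hm _ (fun j => measurableSet_shapeError g j (w j))
    (shapeErrors_eq_sum g w) (by linarith) (measurableSet_le_shapeErrors g w _)⟩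

/-- Two-point argument between opposite vertices: having at least `m / 2` errors against the first
serves as the test, and its complement forces more than `m / 2` errors against the second. If the
error probabilities sum to more than `2 δ`, one of them exceeds `δ`. -/
theorem exists_half_errors (ha : 0 < a) (hK : 1 ≤ K) (hm : 0 < m) (hh : 0 < h) (hhm : h ≤ 1 / m)
    {δ : ℝ} (hδ0 : 0 < δ) (hδ : δ ≤ 1 / 4)
    (hn : n * (h ^ 3 / (m * K)) ≤ 2 * Real.log (1 / δ)) (g : Estimator n) :
    ∃ w : Fin m → Bool, δ < (sampleLaw n (profileDensity a K m h w)).real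
      {X | (m : ℝ) / 16 ≤ shapeErrors a K m h g w X} := by
  have hm' : (0 : ℝ) < m := by positivity
  obtain ⟨h0, h1, h2⟩ := testing_profileDensity (n := n) ha hK hm hh hhm (fun _ => false)
    (fun _ => true) rfl (measurableSet_le_shapeErrors (a := a) (K := K) (h := h) g
      (fun _ : Fin m => false) (m / 2 : ℝ)) rfl
  have hd : hammingDist (fun _ : Fin m => false) (fun _ => true) = m := by
    unfold hammingDist
    simp
  rw [hd] at h0 h1 h2
  have hc : 2 * (n * (m * (h ^ 3 / (1024 * (m : ℝ) ^ 2 * K)))) ≤ Real.log (1 / δ) / 256 := by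
    calc 2 * (n * (m * (h ^ 3 / (1024 * (m : ℝ) ^ 2 * K)))) = n * (h ^ 3 / (m * K)) / 512 := by
          field_simp; ring
      _ ≤ _ := by linarith
  have h3 := two_mul_lt_of_exp_le hδ0 hδ
    ((exp_le_one_sub_pow h0 h1 hc).trans h2)
  have hp : ∀ w : Fin m → Bool, IsProbabilityMeasure (sampleLaw n (profileDensity a K m h w)) :=
    fun w => isProbabilityMeasure_sampleLaw (lintegral_profileDensity w ha hK hm hh hhm) n
  have hA : {X | (m / 2 : ℝ) ≤ shapeErrors a K m h g (fun _ => false) X}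
      ⊆ {X | (m : ℝ) / 16 ≤ shapeErrors a K m h g (fun _ => false) X} := fun X hX => by
    simp only [mem_ofPred_eq] at hX ⊢
    linarith
  have hB : {X | (m / 2 : ℝ) ≤ shapeErrors a K m h g (fun _ => false) X}ᶜ
      ⊆ {X | (m : ℝ) / 16 ≤ shapeErrors a K m h g (fun _ => true) X} := fun X hX => by
    simp only [mem_compl_iff, mem_ofPred_eq, not_le] at hX ⊢
    linarith [shapeErrors_add_compl (a := a) (K := K) (m := m) (h := h) g X]
  have h4 := measureReal_mono (μ := sampleLaw n (profileDensity a K m h fun _ => false)) hA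
  have h5 := measureReal_mono (μ := sampleLaw n (profileDensity a K m h fun _ => true)) hB
  by_contra hcon
  push Not at hcon
  linarith [hcon fun _ => false, hcon fun _ => true]

end Reduction

/-! ### Choice of the parameters and the rates. -/

section Rates

/-- At bandwidth `h` there is an admissible number of steps of the order of `h ^ (1 - β)`. -/
theorem exists_step_count {β h : ℝ} (hβ1 : 1 ≤ β) (hβ2 : β ≤ 2) (hh : 0 < h) (hh1 : h ≤ 1) :
    ∃ m : ℕ, 0 < m ∧ h ≤ 1 / m ∧ 1 / (m : ℝ) ≤ 2 * h ^ (β - 1) ∧ h ^ (β - 1) ≤ 1 / m := by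
  have hone : 1 ≤ h ^ (1 - β) := Real.one_le_rpow_of_pos_of_le_one_of_nonpos hh hh1 (by linarith)
  have hinv : h ^ (1 - β) * h ^ (β - 1) = 1 := by
    rw [← Real.rpow_add hh]; simp
  -- Rounding down loses at most a factor `2` because `h ^ (1 - β) ≥ 1`.
  have hm : 0 < ⌊h ^ (1 - β)⌋₊ := Nat.floor_pos.2 hone
  have hle : (⌊h ^ (1 - β)⌋₊ : ℝ) ≤ h ^ (1 - β) := Nat.floor_le (by positivity)
  have hlt := Nat.lt_floor_add_one (h ^ (1 - β))
  have hm1 : (1 : ℝ) ≤ ⌊h ^ (1 - β)⌋₊ := by exact_mod_cast hm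
  have hpos : 0 < h ^ (β - 1) := by positivity
  have hlow : h ^ (β - 1) ≤ 1 / (⌊h ^ (1 - β)⌋₊ : ℝ) := by
    rw [le_div_iff₀ (by positivity)]
    nlinarith
  refine ⟨_, hm, le_trans ?_ hlow, ?_, hlow⟩
  · exact Real.self_le_rpow_of_le_one hh.le hh1 (by linarith)
  · rw [div_le_iff₀ (by positivity)]
    nlinarith

/-- The largest bandwidth allowed by `h ^ q ≤ x`, capped at `1`; the cap produces the minimum with
`1` in the rates. -/
theorem exists_bandwidth {x q β : ℝ} (hx : 0 < x) (hq : 0 < q) :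
    ∃ h : ℝ, 0 < h ∧ h ≤ 1 ∧ h ^ q ≤ x ∧ min (x ^ (β / q)) 1 ≤ h ^ β := by
  rcases le_or_gt x 1 with h1 | h1
  · refine ⟨x ^ (1 / q), by positivity, Real.rpow_le_one hx.le h1 (by positivity), ?_, ?_⟩
    · rw [← Real.rpow_mul hx.le, one_div_mul_cancel hq.ne', Real.rpow_one]
    · rw [← Real.rpow_mul hx.le, one_div_mul_eq_div]
      exact min_le_left _ _
  · exact ⟨1, one_pos, le_rfl, by rw [Real.one_rpow]; exact h1.le, by
      rw [Real.one_rpow]; exact min_le_right _ _⟩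

variable {β L r r' : ℝ} {n : ℕ}

/-- The reduction from estimation to recovering the shapes, at bandwidth `h`. -/
theorem exists_hard_density (hβ1 : 1 ≤ β) (hβ2 : β ≤ 2) (hL : 0 < L) (hr : 0 < r)
    (hr' : r' = min r (L ^ (2 / β))) {h : ℝ} (hh : 0 < h) (hh1 : h ≤ 1) (g : Estimator n) {P : ℝ → Prop}
    (hP : ∀ (a K : ℝ) (m : ℕ), 0 < a → 1 ≤ K → K = L ^ (2 / β) / r' → 0 < m → h ≤ 1 / m →
      1 / (m : ℝ) ≤ 2 * h ^ (β - 1) → ∃ w : Fin m → Bool,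
        P ((sampleLaw n (profileDensity a K m h w)).real
          {X | (m : ℝ) / 16 ≤ shapeErrors a K m h g w X})) :
    ∃ f ∈ holderFisherClass β L r, ∃ S : Set (Fin n → ℝ), MeasurableSet S ∧
      P ((sampleLaw n f).real S) ∧ ∀ X ∈ S, ENNReal.ofReal (1 / 2 ^ 31 * (r' * h ^ β)) ≤ estLoss g f X := by
  obtain ⟨m, hm, hhm, hm1, hm2⟩ := exists_step_count hβ1 hβ2 hh hh1
  have hLp : 0 < L ^ (2 / β) := by positivity
  have hr0 : 0 < r' := by rw [hr']; exact lt_min hr hLp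
  have hK : 1 ≤ L ^ (2 / β) / r' := by
    rw [one_le_div hr0, hr']; exact min_le_right _ _
  have ha : 0 < L ^ (1 / β) := by positivity
  have haL : (L ^ (1 / β)) ^ β = L := by
    rw [← Real.rpow_mul hL.le, one_div_mul_cancel (by linarith), Real.rpow_one]
  have ha2 : (L ^ (1 / β)) ^ 2 = L ^ (2 / β) := by
    rw [← Real.rpow_natCast, ← Real.rpow_mul hL.le]
    congr 1
    push_cast
    ring
  -- This equality fixes `K`: the Fisher information bound `a ^ 2 / K` becomes `r' ≤ r`, and `r' ≤ L
  -- ^ (2 / β)` ensures `K ≥ 1`.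
  have haK : (L ^ (1 / β)) ^ 2 / (L ^ (2 / β) / r') = r' := by
    rw [ha2]; field_simp
  obtain ⟨w, hw⟩ := hP _ _ m ha hK rfl hm hhm hm1
  generalize L ^ (2 / β) / r' = K at *
  generalize L ^ (1 / β) = a at *
  refine ⟨_, profileDensity_mem w ha hK hm hh hhm hβ1 hβ2 hm1 haL
    (by rw [haK, hr']; exact min_le_left _ _), _, measurableSet_le_shapeErrors g w _, hw,
    fun X hX => le_trans (ENNReal.ofReal_le_ofReal ?_)
      (shapeErrors_mul_le_estLoss w ha hK hm hh hhm g X)⟩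
  have hm' : (0 : ℝ) < m := by positivity
  have hβ : h ^ β = h * h ^ (β - 1) := by
    rw [← Real.rpow_one_add' hh.le (by linarith)]
    congr 1
    ring
  rw [mem_ofPred_eq] at hX
  -- The loss forced by `m / 16` errors; `2 ^ 31 = 16 * 2 ^ 27`.
  calc 1 / 2 ^ 31 * (r' * h ^ β) ≤ 1 / 2 ^ 31 * (r' * (h * (1 / m))) := by
        rw [hβ]; gcongr
    _ = m / 16 * (a ^ 2 * h / (2 ^ 27 * K * m ^ 2)) := by
        rw [← haK]; field_simp; norm_num
    _ ≤ _ := by gcongr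

theorem rate_arg_pos (hL : 0 < L) (hr : 0 < r) (hr' : r' = min r (L ^ (2 / β))) :
    0 < L ^ (2 / β) / r' := by
  have hLp : 0 < L ^ (2 / β) := by positivity
  have hr0 : 0 < r' := by rw [hr']; exact lt_min hr hLp
  positivity

/-- The minimax rate is not attained with probability more than `11 / 16`. -/
theorem exists_density_nonparametric_rate (hβ1 : 1 ≤ β) (hβ2 : β ≤ 2) (hL : 0 < L) (hr : 0 < r)
    (hr' : r' = min r (L ^ (2 / β))) (hn : 1 ≤ n) (g : Estimator n) :
    ∃ f ∈ holderFisherClass β L r, ∃ S : Set (Fin n → ℝ), MeasurableSet S ∧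
      5 / 16 ≤ (sampleLaw n f).real S ∧ ∀ X ∈ S, ENNReal.ofReal (1 / 2 ^ 31 * (r' *
        min ((L ^ (2 / β) / r' * (1 / (n : ℝ))) ^ (β / (2 * β + 1))) 1)) ≤ estLoss g f X := by
  have hn' : (0 : ℝ) < n := by exact_mod_cast hn
  have hx := rate_arg_pos hL hr hr'
  have hr0 : 0 ≤ r' := by rw [hr']; positivity
  obtain ⟨h, hh, hh1, hhq, hhβ⟩ := exists_bandwidth (β := β)
    (show 0 < L ^ (2 / β) / r' * (1 / (n : ℝ)) by positivity) (show 0 < 2 * β + 1 by linarith)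
  obtain ⟨f, hf, S, hS, hp, hX⟩ := exists_hard_density (P := fun p => 5 / 16 ≤ p)
    hβ1 hβ2 hL hr hr' hh hh1 g (by
      intro a K m ha hK hKe hm hhm hm1
      refine exists_many_errors ha hK hm hh hhm ?_ g
      rw [← hKe] at hhq
      have hm' : (0 : ℝ) < m := by positivity
      -- With `1 / m` of order `h ^ (β - 1)`, the information per bit `h ^ 3 / m ^ 2` has order `h ^
      -- (2 β + 1)`.
      have e : h ^ (2 * β + 1) = h ^ 3 * (h ^ (β - 1)) ^ 2 := by
        rw [← Real.rpow_natCast (h ^ (β - 1)), ← Real.rpow_mul hh.le, ← Real.rpow_natCast h,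
          ← Real.rpow_add hh]
        congr 1
        push_cast
        ring
      calc n * (h ^ 3 / (m ^ 2 * K)) = n / K * (h ^ 3 * (1 / m) ^ 2) := by field_simp
        _ ≤ n / K * (h ^ 3 * (2 * h ^ (β - 1)) ^ 2) := by gcongr
        _ = n / K * (4 * h ^ (2 * β + 1)) := by rw [e]; ring
        _ ≤ n / K * (4 * (K * (1 / n))) := by gcongr
        _ = 4 := by field_simp)
  exact ⟨f, hf, S, hS, hp, fun X hXS => (ENNReal.ofReal_le_ofReal (by gcongr)).trans (hX X hXS)⟩

/-- Opposite vertices are `m` bits apart, so the information is `h ^ 3 / m`, of order `h ^ (β + 2)`,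
to be balanced against `K log (1 / δ) / n`. -/
theorem exists_density_deviation_rate (hβ1 : 1 ≤ β) (hβ2 : β ≤ 2) (hL : 0 < L) (hr : 0 < r)
    (hr' : r' = min r (L ^ (2 / β))) (hn : 1 ≤ n) {δ : ℝ} (hδ0 : 0 < δ) (hδ : δ ≤ 1 / 4)
    (g : Estimator n) :
    ∃ f ∈ holderFisherClass β L r, ∃ S : Set (Fin n → ℝ), MeasurableSet S ∧
      δ < (sampleLaw n f).real S ∧ ∀ X ∈ S, ENNReal.ofReal (1 / 2 ^ 31 * (r' *
        min ((L ^ (2 / β) / r' * (Real.log (1 / δ) / (n : ℝ))) ^ (β / (β + 2))) 1))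
          ≤ estLoss g f X := by
  have hn' : (0 : ℝ) < n := by exact_mod_cast hn
  have hx := rate_arg_pos hL hr hr'
  have hr0 : 0 ≤ r' := by rw [hr']; positivity
  have hlog : 0 < Real.log (1 / δ) := Real.log_pos (by rw [lt_div_iff₀ hδ0]; linarith)
  obtain ⟨h, hh, hh1, hhq, hhβ⟩ := exists_bandwidth (β := β)
    (show 0 < L ^ (2 / β) / r' * (Real.log (1 / δ) / (n : ℝ)) by positivity)
    (show 0 < β + 2 by linarith)
  obtain ⟨f, hf, S, hS, hp, hX⟩ := exists_hard_density (P := fun p => δ < p)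
    hβ1 hβ2 hL hr hr' hh hh1 g (by
      intro a K m ha hK hKe hm hhm hm1
      refine exists_half_errors ha hK hm hh hhm hδ0 hδ ?_ g
      rw [← hKe] at hhq
      have hm' : (0 : ℝ) < m := by positivity
      have e : h ^ (β + 2) = h ^ 3 * h ^ (β - 1) := by
        rw [← Real.rpow_natCast h, ← Real.rpow_add hh]
        congr 1
        push_cast
        ring
      calc n * (h ^ 3 / (m * K)) = n / K * (h ^ 3 * (1 / m)) := by field_simp
        _ ≤ n / K * (h ^ 3 * (2 * h ^ (β - 1))) := by gcongr
        _ = n / K * (2 * h ^ (β + 2)) := by rw [e]; ring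
        _ ≤ n / K * (2 * (K * (Real.log (1 / δ) / n))) := by gcongr
        _ = 2 * Real.log (1 / δ) := by field_simp)
  exact ⟨f, hf, S, hS, hp, fun X hXS => (ENNReal.ofReal_le_ofReal (by gcongr)).trans (hX X hXS)⟩

/-- Allows the two rates to come from different densities: their sum costs only a factor `2` over
the larger one. -/
theorem min_add_one_le (x y : ℝ) :
    min (x + y) 1 ≤ 2 * max (min x 1) (min y 1) := by
  rcases le_total x 1 with h1 | h1
  · rcases le_total y 1 with h2 | h2
    · rw [min_eq_left h1, min_eq_left h2]
      linarith [min_le_left (x + y) 1, le_max_left x y, le_max_right x y]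
    · rw [min_eq_right h2]
      linarith [min_le_right (x + y) 1, le_max_right (min x 1) (1 : ℝ)]
  · rw [min_eq_right h1]
    linarith [min_le_right (x + y) 1, le_max_left (1 : ℝ) (min y 1)]

end Rates

end ScoreEstimation

/-! ### The minimax lower bounds. -/

theorem theorem5 :
    (∀ β : ℝ, 1 ≤ β → β ≤ 2 → ∃ c : ℝ, 0 < c ∧
      ∀ (n : ℕ) (δ L r : ℝ), 1 ≤ n → 0 < δ → δ ≤ 1 / 4 → 0 < L → 0 < r →
        ∀ r' : ℝ, r' = min r (L ^ (2 / β)) →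
          ENNReal.ofReal (c * (r' *
            min ((L ^ (2 / β) / r' * (1 / (n : ℝ))) ^ (β / (2 * β + 1))
              + (L ^ (2 / β) / r' * (Real.log (1 / δ) / (n : ℝ))) ^ (β / (β + 2))) 1))
            ≤ ScoreEstimation.minimaxQuantile n δ (ScoreEstimation.holderFisherClass β L r)) ∧
    (∃ c : ℝ, 0 < c ∧
      ∀ (β : ℝ), 1 ≤ β → β ≤ 2 → ∀ (n : ℕ) (L r : ℝ), 1 ≤ n → 0 < L → 0 < r →
        ∀ r' : ℝ, r' = min r (L ^ (2 / β)) →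
          ENNReal.ofReal (c * (r' *
            min ((L ^ (2 / β) / r' * (1 / (n : ℝ))) ^ (β / (2 * β + 1))) 1))
            ≤ ScoreEstimation.minimaxRisk n (ScoreEstimation.holderFisherClass β L r)) := by
  -- Both constants are absolute; in particular the one in the quantile bound does not vary with
  -- `β`.
  refine ⟨fun β hβ1 hβ2 => ⟨1 / 2 ^ 32, by norm_num, ?_⟩, ⟨5 / 16 * (1 / 2 ^ 31), by norm_num, ?_⟩⟩
  · intro n δ L r hn hδ0 hδ hL hr r' hr'
    have hr0 : 0 ≤ r' := by rw [hr']; positivity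
    refine le_iInf fun g => ?_
    obtain ⟨f₁, hf₁, S₁, hS₁, hp₁, hX₁⟩ :=
      ScoreEstimation.exists_density_nonparametric_rate hβ1 hβ2 hL hr hr' hn g
    obtain ⟨f₂, hf₂, S₂, hS₂, hp₂, hX₂⟩ :=
      ScoreEstimation.exists_density_deviation_rate hβ1 hβ2 hL hr hr' hn hδ0 hδ g
    -- The first rate bounds every quantile considered because `δ ≤ 1 / 4 < 5 / 16`.
    have h1 := (ScoreEstimation.le_lossQuantile hf₁.1.1.lintegral_eq_one hS₁
      (δ := δ) (by linarith) hX₁).trans (le_iSup₂ (f := fun f _ =>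
        ScoreEstimation.lossQuantile δ g f) f₁ hf₁)
    have h2 := (ScoreEstimation.le_lossQuantile hf₂.1.1.lintegral_eq_one hS₂
      hp₂ hX₂).trans (le_iSup₂ (f := fun f _ => ScoreEstimation.lossQuantile δ g f) f₂ hf₂)
    generalize (L ^ (2 / β) / r' * (1 / (n : ℝ))) ^ (β / (2 * β + 1)) = A at *
    generalize (L ^ (2 / β) / r' * (Real.log (1 / δ) / (n : ℝ))) ^ (β / (β + 2)) = B at *
    have h3 := ScoreEstimation.min_add_one_le A B
    have h4 : 1 / 2 ^ 32 * (r' * min (A + B) 1)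
        ≤ 1 / 2 ^ 31 * (r' * max (min A 1) (min B 1)) := by
      calc 1 / 2 ^ 32 * (r' * min (A + B) 1)
          ≤ 1 / 2 ^ 32 * (r' * (2 * max (min A 1) (min B 1))) := by gcongr
        _ = _ := by ring
    refine (ENNReal.ofReal_le_ofReal h4).trans ?_
    rcases max_cases (min A 1) (min B 1) with ⟨e, _⟩ | ⟨e, _⟩ <;> rw [e]
    · exact h1
    · exact h2
  · intro β hβ1 hβ2 n L r hn hL hr r' hr'
    refine le_iInf fun g => ?_
    obtain ⟨f, hf, S, hS, hp, hX⟩ :=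
      ScoreEstimation.exists_density_nonparametric_rate hβ1 hβ2 hL hr hr' hn g
    rw [mul_assoc]
    exact (ScoreEstimation.le_lintegral_estLoss hf.1.1.lintegral_eq_one hS (by norm_num) hp hX).trans
      (le_iSup₂ (f := fun f _ => ∫⁻ X, ScoreEstimation.estLoss g f X
        ∂(ScoreEstimation.sampleLaw n f)) f hf)
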